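/- Let $p>0$, $0<r<\alpha$, $\delta>r$ and $\lambda>0$. On a complete probability space let $N$ be a Poisson process of rate $\lambda$, let $U_1,U_2,\dots\ge 0$ be i.i.d. with distribution $F$ and independent of $N$, let $Y_t=\sum_{i=1}^{N(t)}U_i$, and let $\mathcal F_t$ be the $\sigma$-algebra generated by $(Y_s)_{s\le t}$ and all null sets. For an initial reserve $x$ and a cumulative dividend process $L$ the reserve $R=R^{x,L}$ is the solution of $$R_t=x+\int_0^t\bigl(p+rR_s\mathbf 1_{\{R_s\ge0\}}+\alpha R_s\mathbf 1_{\{R_s<0\}}\bigr)\,ds-Y_t-L_t,\qquad t\ge 0,$$ and the time of ruin is $T=\inf\{t\ge0: R_t\le -p/\alpha\}$. A strategy $L$ is admissible for $x$ if it is $(\mathcal F_t)$-predictable, nondecreasing and left-continuous with $L_0=0$, and no lump sum takes the reserve below the critical level: $L_{t+}-L_t\le\max(R_t+p/\alpha,\,0)$ for all $t\le T$. The value function is $$V(x)=\sup_{L\ \text{admissible for }x}\ \mathbb E\Bigl[\int_{[0,T]}e^{-\delta s}\,dL_s\Bigr],$$ where a lump sum at time $0$ or at time $T$ is counted. For $-p/\alpha<x<y$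 put $$t_0(x,y)=\begin{cases}\frac1r\log\frac{ry+p}{rx+p}, & y>x\ge0,\\[2pt] \frac1r\log\frac{ry+p}{p}+\frac1\alpha\log\frac{p}{\alpha x+p}, & y>0>x,\\[2pt] \frac1\alpha\log\frac{\alpha y+p}{\alpha x+p}, & 0\ge y>x.\end{cases}$$ Theorem. For all $y>x>-p/\alpha$ the values $V(x)$ and $V(y)$ are finite, $$y-x\le V(y)-V(x)\le V(x)\bigl(e^{(\lambda+\delta)t_0(x,y)}-1\bigr),$$ and, written explicitly, $$V(y)-V(x)\le V(x)\begin{cases}\bigl(\frac{ry+p}{rx+p}\bigr)^{\frac{\lambda+\delta}{r}}-1, & y>x\ge 0,\\[2pt] \bigl(\frac{ry+p}{p}\bigr)^{\frac{\lambda+\delta}{r}}\bigl(\frac{p}{\alpha x+p}\bigr)^{\frac{\lambda+\delta}{\alpha}}-1, & y\ge0>x>-\frac p\alpha,\\[2pt] \bigl(\frac{\alpha y+p}{\alpha x+p}\bigr)^{\frac{\lambda+\delta}{\alpha}}-1, & 0>y>x>-\frac p\alpha.\end{cases}$$ -/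

import Mathlib

open MeasureTheory ProbabilityTheory
open scoped NNReal ENNReal

noncomputable section

namespace DividendControl

/-- A Poisson process `N` with rate `lam`: it starts at `0`, has nondecreasing right-continuous
paths in `ℕ`, independent increments, and `N t - N s` is Poisson with mean `lam * (t - s)`. -/
structure IsPoissonProcess {Ω : Type*} [MeasurableSpace Ω] (μ : Measure Ω) (lam : ℝ)
    (N : ℝ≥0 → Ω → ℕ) : Prop where
  measurable : ∀ t, Measurable (N t)
  zero : ∀ᵐ ω ∂μ, N 0 ω = 0
  monotone : ∀ᵐ ω ∂μ, Monotone fun t => N t ω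
  rightCont : ∀ᵐ ω ∂μ, ∀ t, ContinuousWithinAt (fun s => N s ω) (Set.Ici t) t
  indep : HasIndepIncrements (fun t ω => (N t ω : ℝ)) μ
  law : ∀ s t : ℝ≥0, s ≤ t →
    μ.map (fun ω => (N t ω : ℝ) - N s ω)
      = (poissonMeasure (Real.toNNReal (lam * (t - s)))).map (fun n : ℕ => (n : ℝ))

/-- The claims: a Poisson number process `N` with rate `lam`, and nonnegative i.i.d. claim sizes
`U 0, U 1, …` with law `F`, the whole sequence being independent of the process `N`. -/
structure Claims {Ω : Type*} [MeasurableSpace Ω] (μ : Measure Ω) (lam : ℝ) (F : Measure ℝ) where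
  /-- number of claims up to time `t` -/
  N : ℝ≥0 → Ω → ℕ
  /-- claim sizes -/
  U : ℕ → Ω → ℝ
  poisson : IsPoissonProcess μ lam N
  measurable_U : ∀ i, Measurable (U i)
  law_U : ∀ i, μ.map (U i) = F
  nonneg_law : F (Set.Iio 0) = 0
  iIndep_U : iIndepFun U μ
  indep_U_N : IndepFun (fun ω i => U i ω) (fun ω t => N t ω) μ

variable {Ω : Type*} [mΩ : MeasurableSpace Ω] {μ : Measure Ω} {lam : ℝ} {F : Measure ℝ}

/-- The aggregate claim amount `Y t`, the sum of the first `N t` claims. -/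
def Claims.Y (C : Claims μ lam F) (t : ℝ≥0) (ω : Ω) : ℝ :=
  ∑ i ∈ Finset.range (C.N t ω), C.U i ω

theorem Claims.measurable_Y (C : Claims μ lam F) (t : ℝ≥0) : Measurable (C.Y t) := by
  have h : Measurable fun q : ℕ × Ω => ∑ i ∈ Finset.range q.1, C.U i q.2 :=
    measurable_from_prod_countable_right fun n =>
      Finset.measurable_fun_sum (Finset.range n) fun i _ => C.measurable_U i
  exact h.comp ((C.poisson.measurable t).prodMk measurable_id)

/-- The filtration generated by the aggregate claims, augmented by all null sets. -/
def Claims.filtration (C : Claims μ lam F) [μ.IsComplete] : Filtration ℝ≥0 mΩ where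
  seq t := (⨆ s ≤ t, MeasurableSpace.comap (C.Y s) inferInstance) ⊔
    MeasurableSpace.generateFrom {A | μ A = 0}
  mono' _ _ hst := sup_le_sup_right (biSup_mono fun _ h => h.trans hst) _
  le' t := by
    refine sup_le (iSup₂_le fun s _ => (C.measurable_Y s).comap_le) ?_
    exact MeasurableSpace.generateFrom_le fun A hA => measurableSet_of_null hA

/-- Rate of change of the reserve at level `z` between claims and dividends: premium rate `p`,
credit interest `r` on a nonnegative reserve, debit interest `α` on a negative one. -/
def drift (p r α z : ℝ) : ℝ := p + if 0 ≤ z then r * z else α * z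

/-- `R` is the reserve with initial value `x` under the cumulative dividends `L`, i.e.
`R t = x + ∫₀ᵗ drift (R s) ds - Y t - L t` for all `t ≥ 0`, almost surely. (The values `R (s-)`
and `R s` differ for at most countably many `s`, so they give the same integral.) -/
def Claims.IsReserve (C : Claims μ lam F) (p r α x : ℝ) (L R : ℝ≥0 → Ω → ℝ) : Prop :=
  ∀ᵐ ω ∂μ, ∀ t : ℝ≥0,
    IntervalIntegrable (fun s : ℝ => drift p r α (R s.toNNReal ω)) volume 0 t ∧
    R t ω = x + (∫ s in (0 : ℝ)..t, drift p r α (R s.toNNReal ω)) - C.Y t ω - L t ω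

/-- The time of ruin of a reserve path: `inf {t ≥ 0 | ρ t ≤ -p/α}`, which is `∞` if the path
stays above the critical value `-p/α`. -/
def ruinTime (p α : ℝ) (ρ : ℝ≥0 → ℝ) : ℝ≥0∞ :=
  ⨅ (t : ℝ≥0) (_ : ρ t ≤ -(p / α)), (t : ℝ≥0∞)

/-- `L` is an admissible dividend strategy for the initial reserve `x`, with controlled reserve
`R`: it is predictable, starts at `0`, is nondecreasing and left-continuous (right limits then
exist), and no lump sum `L (t+) - L t` paid up to the time of ruin takes the reserve below the
critical value `-p/α`; in particular nothing is paid out once a claim has caused ruin. -/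
structure Claims.IsAdmissible (C : Claims μ lam F) [μ.IsComplete] (p r α x : ℝ)
    (L R : ℝ≥0 → Ω → ℝ) : Prop where
  predictable : IsStronglyPredictable C.filtration L
  zero : ∀ᵐ ω ∂μ, L 0 ω = 0
  monotone : ∀ᵐ ω ∂μ, Monotone fun t => L t ω
  leftCont : ∀ᵐ ω ∂μ, ∀ t, ContinuousWithinAt (fun s => L s ω) (Set.Iic t) t
  reserve : C.IsReserve p r α x L R
  lump_le : ∀ᵐ ω ∂μ, ∀ t : ℝ≥0, (t : ℝ≥0∞) ≤ ruinTime p α (fun s => R s ω) →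
    Function.rightLim (fun s => L s ω) t - L t ω ≤ max (R t ω + p / α) 0

open Classical in
/-- The Lebesgue–Stieltjes measure `dℓ` on `ℝ` of a nondecreasing path `ℓ` on `[0, ∞)`, extended
by the constant `ℓ 0` to negative times. It gives mass `ℓ (t+) - ℓ (t-)` to `{t}` for `t > 0` and
mass `ℓ (0+) - ℓ 0` to `{0}`. (For a path that is not monotone it is `0` by convention.) -/
def stieltjes (ℓ : ℝ≥0 → ℝ) : Measure ℝ :=
  if h : Monotone ℓ then (h.comp (fun _ _ hab => Real.toNNReal_mono hab : Monotone Real.toNNReal)).stieltjesFunction.measure else 0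

/-- The return `𝔼 ∫_[0,T] e^{-δ s} dL s`, where `T` is the time of ruin of `R`. Lump sums at the
times `0` and `T` count. -/
def returnValue (μ : Measure Ω) (p α δ : ℝ) (L R : ℝ≥0 → Ω → ℝ) : ℝ≥0∞ :=
  ∫⁻ ω, ∫⁻ s in {s : ℝ | 0 ≤ s ∧ ENNReal.ofReal s ≤ ruinTime p α (fun t => R t ω)},
    ENNReal.ofReal (Real.exp (-(δ * s))) ∂(stieltjes fun t => L t ω) ∂μ

/-- The optimal return for the initial reserve `x`: the supremum of the return over all
admissible strategies. A priori it may be infinite. -/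
def Claims.optimalReturn (C : Claims μ lam F) [μ.IsComplete] (p r α δ x : ℝ) : ℝ≥0∞ :=
  ⨆ (L : ℝ≥0 → Ω → ℝ) (R : ℝ≥0 → Ω → ℝ) (_ : C.IsAdmissible p r α x L R),
    returnValue μ p α δ L R

/-- The value function as a real number (meaningful where `optimalReturn` is finite). -/
def Claims.V (C : Claims μ lam F) [μ.IsComplete] (p r α δ x : ℝ) : ℝ :=
  (C.optimalReturn p r α δ x).toReal

/-- The time that the reserve takes to climb from `x` to `y`, for `-p/α < x < y`, when there are
neither claims nor dividends. -/
def t₀ (p r α x y : ℝ) : ℝ :=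
  if 0 ≤ x then 1 / r * Real.log ((r * y + p) / (r * x + p))
  else if 0 < y then
    1 / r * Real.log ((r * y + p) / p) + 1 / α * Real.log (p / (α * x + p))
  else 1 / α * Real.log ((α * y + p) / (α * x + p))

end DividendControl

end

/-! Two comparisons of strategies carry the proof. For the lower bound, a strategy for `x` becomes
one for `y` by paying `y - x` at time `0`: the reserve at positive times and the ruin time do not
change, and the return grows by exactly `y - x` (`AdmissiblePath.pathReturn_withLump`). For the
upper bound, start at `x`, pay nothing during the time `θ` in which the undisturbed reserve climbs
to `y`, and then, if no claim amount has accrued, apply a strategy for `y` to the claims after `θ`.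
Discounting costs `e^{-δθ}` and the event has probability at least `e^{-λθ}`, so `e^{-(λ+δ)θ} V(y) ≤
V(x)` (`Claims.mul_optimalReturn_le`).

Finiteness: by Fubini a return is `∫ δ e^{-δu} L((u ∧ T)+) du` (`setLIntegral_stieltjes`), and up to
ruin `L` grows at most like `e^{ru}` with `r < δ` (`IsReservePath.rightLim_le`).

The delicate point is restarting a strategy, since `L` is only a process on `Ω`, predictable for an
augmented filtration. A left-continuous path is determined by its values at a dense sequence of
times, and each value is almost surely a measurable function of the claim path up to that time
(`Claims.exists_factor`). The reserve (by Picard iteration), the ruin time (a ruined reserve never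
recovers, so dense times suffice), admissibility and the return thus become measurable functionals
of the claim path. They transfer to the shifted claims because on `{Y θ = 0}` these have the
original law up to a factor (`Claims.map_shiftPath`). The event is not `{N θ = 0}`, because claims
of size zero are invisible to the filtration. -/

namespace DividendControl

open Filter Topology Set

/-! ### Grönwall's inequality and Picard iteration -/

/-- Integral form of Grönwall's inequality, without continuity of `f`. -/
theorem le_mul_exp_of_le_add_integral {f : ℝ → ℝ} {a K T : ℝ} (hT : 0 ≤ T) (hK : 0 ≤ K)
    (hf : IntervalIntegrable f volume 0 T)
    (h : ∀ t ∈ Icc 0 T, f t ≤ a + K * ∫ s in (0 : ℝ)..t, f s) :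
    f T ≤ a * Real.exp (K * T) := by
  have hsub : ∀ t ∈ Icc 0 T, IntervalIntegrable f volume 0 t := fun t ht =>
    hf.mono_set (by rw [uIcc_of_le ht.1, uIcc_of_le hT]; exact Icc_subset_Icc_right ht.2)
  set h' : ℝ → ℝ := fun t => a + K * ∫ s in (0 : ℝ)..t, f s with hh'
  have hcont : ContinuousOn h' (Icc 0 T) := by
    have := intervalIntegral.continuousOn_primitive_interval (f := f) (μ := volume) (a := 0) (b := T)
      (by rw [uIcc_of_le hT]; exact (intervalIntegrable_iff_integrableOn_Icc_of_le hT).1 hf)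
    rw [uIcc_of_le hT] at this
    exact continuousOn_const.add (continuousOn_const.mul this)
  have hint : ∀ t ∈ Icc 0 T, IntervalIntegrable h' volume 0 t := fun t ht =>
    (hcont.mono (by rw [uIcc_of_le ht.1]; exact Icc_subset_Icc_right ht.2)).intervalIntegrable
  -- Since `f` need not be continuous, the bound is iterated once: `h'` is continuous, so its
  -- primitive `H` is differentiable and satisfies a differential inequality.
  set H : ℝ → ℝ := fun t => ∫ s in (0 : ℝ)..t, h' s with hH
  have hle : ∀ t ∈ Icc 0 T, h' t ≤ a + K * H t := by
    intro t ht
    have : (∫ s in (0 : ℝ)..t, f s) ≤ H t :=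
      intervalIntegral.integral_mono_on ht.1 (hsub t ht) (hint t ht)
        fun s hs => h s ⟨hs.1, hs.2.trans ht.2⟩
    simp only [hh']
    gcongr
  have hHc : ContinuousOn H (Icc 0 T) := by
    have := intervalIntegral.continuousOn_primitive_interval (f := h') (μ := volume) (a := 0) (b := T)
      (by rw [uIcc_of_le hT]
          exact (intervalIntegrable_iff_integrableOn_Icc_of_le hT).1 (hint T ⟨hT, le_rfl⟩))
    rwa [uIcc_of_le hT] at this
  have hHd : ∀ t ∈ Ioo 0 T, HasDerivAt H (h' t) t := by
    intro t ht
    refine intervalIntegral.integral_hasDerivAt_right (hint t (Ioo_subset_Icc_self ht)) ?_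
      (hcont.continuousAt (Icc_mem_nhds ht.1 ht.2))
    exact (hcont.mono Ioo_subset_Icc_self).stronglyMeasurableAtFilter isOpen_Ioo t ht
  set φ : ℝ → ℝ := fun t => Real.exp (-(K * t)) * (a + K * H t) with hφ
  have hφd : ∀ t ∈ Ioo 0 T,
      HasDerivAt φ (Real.exp (-(K * t)) * (K * (h' t - (a + K * H t)))) t := by
    intro t ht
    have h1 : HasDerivAt (fun t => Real.exp (-(K * t))) (Real.exp (-(K * t)) * -(K * 1)) t :=
      (((hasDerivAt_id t).const_mul K).neg).exp
    have h2 := h1.mul (((hHd t ht).const_mul K).const_add a)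
    exact h2.congr_deriv (by ring)
  have hanti : AntitoneOn φ (Icc 0 T) := by
    refine antitoneOn_of_deriv_nonpos (convex_Icc 0 T) ?_ ?_ ?_
    · exact (by fun_prop : Continuous fun t => Real.exp (-(K * t))).continuousOn.mul
        (continuousOn_const.add (continuousOn_const.mul hHc))
    · rw [interior_Icc]
      exact fun t ht => (hφd t ht).differentiableAt.differentiableWithinAt
    · rw [interior_Icc]
      intro t ht
      rw [(hφd t ht).deriv]
      have := hle t (Ioo_subset_Icc_self ht)
      exact mul_nonpos_of_nonneg_of_nonpos (Real.exp_pos _).le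
        (mul_nonpos_of_nonneg_of_nonpos hK (by linarith))
  have h0 : φ T ≤ φ 0 := hanti ⟨le_rfl, hT⟩ ⟨hT, le_rfl⟩ hT
  have h00 : φ 0 = a := by simp [hφ, hH]
  have hTT : f T ≤ a + K * H T := (h T ⟨hT, le_rfl⟩).trans (hle T ⟨hT, le_rfl⟩)
  have hexp : Real.exp (K * T) * φ T = a + K * H T := by
    simp only [hφ]
    rw [← mul_assoc, ← Real.exp_add]
    simp
  calc f T ≤ Real.exp (K * T) * φ T := hexp ▸ hTT
    _ ≤ Real.exp (K * T) * a := by rw [← h00]; gcongr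
    _ = a * Real.exp (K * T) := mul_comm _ _

/-- Picard iterates of the equation `w t = x + ∫₀ᵗ b (w s - g s) ds`. -/
noncomputable def picard (b : ℝ → ℝ) (x : ℝ) (g : ℝ → ℝ) : ℕ → ℝ → ℝ
  | 0, _ => x
  | n + 1, t => x + ∫ s in Ioc 0 t, b (picard b x g n s - g s)

/-- Joint measurability in parameter and time is what later makes the reserve a measurable function
of the claim and dividend samples. -/
theorem measurable_picard {A : Type*} [MeasurableSpace A] {b : ℝ → ℝ} (hb : Measurable b) (x : ℝ)
    {g : A → ℝ → ℝ} (hg : Measurable (Function.uncurry g)) (n : ℕ) :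
    Measurable fun q : A × ℝ => picard b x (g q.1) n q.2 := by
  induction n with
  | zero => exact measurable_const
  | succ n ih =>
    simp only [picard]
    refine measurable_const.add ?_
    have h1 : Measurable fun q : (A × ℝ) × ℝ =>
        (Ioc 0 q.1.2).indicator (fun s => b (picard b x (g q.1.1) n s - g q.1.1 s)) q.2 := by
      have hm : MeasurableSet {q : (A × ℝ) × ℝ | q.2 ∈ Ioc 0 q.1.2} :=
        (measurableSet_lt measurable_const measurable_snd).inter
          (measurableSet_le measurable_snd (by fun_prop))
      have h2 : Measurable fun q : (A × ℝ) × ℝ => (q.1.1, q.2) := by fun_prop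
      have h3 : Measurable fun q : (A × ℝ) × ℝ => b (picard b x (g q.1.1) n q.2 - g q.1.1 q.2) :=
        hb.comp ((ih.comp h2).sub (hg.comp h2))
      exact h3.indicator hm
    have h4 := StronglyMeasurable.integral_prod_right' (ν := volume) h1.stronglyMeasurable
    simpa only [integral_indicator measurableSet_Ioc] using h4.measurable

theorem measurable_picard_path {b : ℝ → ℝ} (hb : Measurable b) (x : ℝ) {g : ℝ → ℝ}
    (hg : Measurable g) (n : ℕ) : Measurable (picard b x g n) :=
  (measurable_picard (A := Unit) (g := fun _ => g) hb x (hg.comp measurable_snd) n).comp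
    (measurable_const.prodMk measurable_id : Measurable fun t : ℝ => (((), t) : Unit × ℝ))

section Picard

variable {b : ℝ → ℝ} {K : ℝ≥0} {x : ℝ} {g : ℝ → ℝ}

theorem abs_le_of_lipschitz (hb : LipschitzWith K b) (z : ℝ) : |b z| ≤ |b 0| + K * |z| := by
  have := hb.dist_le_mul z 0
  simp only [Real.dist_eq, sub_zero] at this
  have h2 : |b z| ≤ |b 0| + |b z - b 0| := by
    have := abs_add_le (b 0) (b z - b 0); simpa using this
  linarith

theorem abs_le_of_monotone (hg : Monotone g) {T s : ℝ} (hs : s ∈ Icc 0 T) :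
    |g s| ≤ |g 0| + |g T| := by
  rw [abs_le]
  have h1 := hg hs.1
  have h2 := hg hs.2
  have := neg_abs_le (g 0)
  have := le_abs_self (g T)
  have := abs_nonneg (g 0)
  have := abs_nonneg (g T)
  constructor <;> linarith

theorem integrableOn_comp_sub (hb : LipschitzWith K b) (hg : Monotone g) {w : ℝ → ℝ}
    (hw : Measurable w) {T C : ℝ} (hC : ∀ s ∈ Icc 0 T, |w s| ≤ C) :
    IntegrableOn (fun s => b (w s - g s)) (Ioc 0 T) := by
  refine Measure.integrableOn_of_bounded (M := |b 0| + K * (C + (|g 0| + |g T|)))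
    (by simp) (hb.continuous.measurable.comp (hw.sub hg.measurable)).aestronglyMeasurable ?_
  refine (ae_restrict_iff' measurableSet_Ioc).2 (ae_of_all _ fun s hs => ?_)
  have hs' := Ioc_subset_Icc_self hs
  have h3 := abs_le_of_monotone hg hs'
  have h4 := hC s hs'
  refine (abs_le_of_lipschitz hb _).trans ?_
  gcongr
  exact (abs_sub _ _).trans (by gcongr)

theorem picard_bounded (hb : LipschitzWith K b) (hg : Monotone g) (T : ℝ) (n : ℕ) :
    ∃ C, ∀ s ∈ Icc 0 T, |picard b x g n s| ≤ C := by
  induction n with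
  | zero => exact ⟨|x|, fun s _ => le_rfl⟩
  | succ n ih =>
    obtain ⟨C, hC⟩ := ih
    have hi := integrableOn_comp_sub hb hg
      (measurable_picard_path hb.continuous.measurable x hg.measurable n) hC
    refine ⟨|x| + ∫ s in Ioc 0 T, |b (picard b x g n s - g s)|, fun s hs => ?_⟩
    simp only [picard]
    refine (abs_add_le _ _).trans ?_
    gcongr
    refine abs_integral_le_integral_abs.trans ?_
    exact setIntegral_mono_set hi.abs (ae_of_all _ fun _ => abs_nonneg _)
      (Ioc_subset_Ioc_right hs.2).eventuallyLE

theorem integrableOn_picard (hb : LipschitzWith K b) (hg : Monotone g) (T : ℝ) (n : ℕ) :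
    IntegrableOn (fun s => b (picard b x g n s - g s)) (Ioc 0 T) := by
  obtain ⟨C, hC⟩ := picard_bounded (x := x) hb hg T n
  exact integrableOn_comp_sub hb hg
    (measurable_picard_path hb.continuous.measurable x hg.measurable n) hC

/-- The weight `exp (2 * K * t)` makes each Picard step a contraction by `1/2` on all of `[0, T]`,
however long, because `∫₀ᵗ K e^{2Ks} ds ≤ e^{2Kt} / 2`. -/
theorem abs_picard_succ_sub_le (hb : LipschitzWith K b) (hg : Monotone g) (T : ℝ) :
    ∃ C, ∀ n, ∀ t ∈ Icc 0 T, |picard b x g (n + 1) t - picard b x g n t|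
      ≤ C * (1 / 2) ^ n * Real.exp (2 * K * t) := by
  obtain ⟨C, hC⟩ := picard_bounded (x := x) hb hg T 1
  have hK : (0 : ℝ) ≤ K := K.2
  refine ⟨|C| + |x|, fun n => ?_⟩
  induction n with
  | zero =>
    intro t ht
    have h1 : (1 : ℝ) ≤ Real.exp (2 * K * t) :=
      Real.one_le_exp (by have := ht.1; positivity)
    have h2 : |picard b x g 1 t - picard b x g 0 t| ≤ |C| + |x| :=
      (abs_sub _ _).trans (add_le_add ((hC t ht).trans (le_abs_self _)) le_rfl)
    simp only [pow_zero, mul_one, zero_add]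
    nlinarith [abs_nonneg C, abs_nonneg x]
  | succ n ih =>
    intro t ht
    set D := |C| + |x|
    have e1 : picard b x g (n + 1 + 1) t - picard b x g (n + 1) t
        = ∫ s in Ioc 0 t, (b (picard b x g (n + 1) s - g s) - b (picard b x g n s - g s)) := by
      rw [integral_sub (integrableOn_picard hb hg t (n + 1)) (integrableOn_picard hb hg t n)]
      simp only [picard]
      ring
    have hcont : Continuous fun s : ℝ => K * (D * (1 / 2) ^ n * Real.exp (2 * K * s)) := by fun_prop
    rw [e1]
    calc |∫ s in Ioc 0 t, (b (picard b x g (n + 1) s - g s) - b (picard b x g n s - g s))|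
        ≤ ∫ s in Ioc 0 t, |b (picard b x g (n + 1) s - g s) - b (picard b x g n s - g s)| :=
          abs_integral_le_integral_abs
      _ ≤ ∫ s in Ioc 0 t, K * (D * (1 / 2) ^ n * Real.exp (2 * K * s)) := by
          refine setIntegral_mono_on ((integrableOn_picard hb hg t (n + 1)).sub
            (integrableOn_picard hb hg t n)).abs
            (hcont.integrableOn_Icc.mono_set Ioc_subset_Icc_self) measurableSet_Ioc ?_
          intro s hs
          have h1 := hb.dist_le_mul (picard b x g (n + 1) s - g s) (picard b x g n s - g s)
          simp only [Real.dist_eq, sub_sub_sub_cancel_right] at h1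
          refine h1.trans ?_
          gcongr
          exact ih s ⟨hs.1.le, hs.2.trans ht.2⟩
      _ ≤ D * (1 / 2) ^ (n + 1) * Real.exp (2 * K * t) := by
          rw [← intervalIntegral.integral_of_le ht.1]
          have hd : ∀ s ∈ uIcc 0 t, HasDerivAt
              (fun s : ℝ => D * (1 / 2) ^ (n + 1) * Real.exp (2 * K * s))
              (K * (D * (1 / 2) ^ n * Real.exp (2 * K * s))) s := by
            intro s _
            have := (((hasDerivAt_id s).const_mul (2 * (K : ℝ))).exp).const_mul
              (D * (1 / 2) ^ (n + 1))
            exact this.congr_deriv (by simp only [id]; ring)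
          rw [intervalIntegral.integral_eq_sub_of_hasDerivAt hd (hcont.intervalIntegrable _ _)]
          have : 0 ≤ D * (1 / 2) ^ (n + 1) * Real.exp (2 * K * 0) := by positivity
          linarith

/-- The limit of the Picard iterates. -/
noncomputable def picardLim (b : ℝ → ℝ) (x : ℝ) (g : ℝ → ℝ) (t : ℝ) : ℝ :=
  limsup (fun n => picard b x g n t) atTop

/-- A `limsup` is measurable whether or not the iterates converge, so samples that come from no path
do no harm. -/
theorem measurable_picardLim {A : Type*} [MeasurableSpace A] {b : ℝ → ℝ} (hb : Measurable b)
    (x : ℝ) {g : A → ℝ → ℝ} (hg : Measurable fun q : A × ℝ => g q.1 q.2) {t : A → ℝ}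
    (ht : Measurable t) : Measurable fun z => picardLim b x (g z) (t z) :=
  Measurable.limsup fun n => (measurable_picard hb x hg n).comp (measurable_id.prodMk ht)

theorem exists_picard_bound (hb : LipschitzWith K b) (hg : Monotone g) (T : ℝ) :
    ∃ C, ∀ t ∈ Icc 0 T, Tendsto (fun n => picard b x g n t) atTop (𝓝 (picardLim b x g t)) ∧
      ∀ n, |picard b x g n t| ≤ C := by
  obtain ⟨C, hC⟩ := abs_picard_succ_sub_le (x := x) hb hg T
  have hK : (0 : ℝ) ≤ K := K.2
  set D := |C * Real.exp (2 * K * T)|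
  refine ⟨|x| + (2 * D + 2 * D), fun t ht => ?_⟩
  have hd : ∀ n, dist (picard b x g n t) (picard b x g (n + 1) t) ≤ 2 * D / 2 / 2 ^ n := by
    intro n
    rw [dist_comm, Real.dist_eq]
    refine (hC n t ht).trans ?_
    have h1 : Real.exp (2 * K * t) ≤ Real.exp (2 * K * T) := by
      have := ht.2
      gcongr
    have h2 : 0 ≤ C * Real.exp (2 * K * t) := by
      have := (abs_nonneg _).trans (hC 0 t ht); simpa using this
    have h3 : 0 ≤ C := nonneg_of_mul_nonneg_left h2 (Real.exp_pos _)
    calc C * (1 / 2) ^ n * Real.exp (2 * K * t) ≤ C * (1 / 2) ^ n * Real.exp (2 * K * T) := by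
          gcongr
      _ = C * Real.exp (2 * K * T) * (1 / 2) ^ n := by ring
      _ ≤ D * (1 / 2) ^ n := by gcongr; exact le_abs_self _
      _ = 2 * D / 2 / 2 ^ n := by rw [one_div, inv_pow]; ring
  obtain ⟨l, hl⟩ := cauchySeq_tendsto_of_complete (cauchySeq_of_le_geometric_two hd)
  constructor
  · rw [picardLim, hl.limsup_eq]; exact hl
  · intro n
    have h0 := dist_le_of_le_geometric_two_of_tendsto₀ hd hl
    have hn := dist_le_of_le_geometric_two_of_tendsto hd hl n
    have hn' : 2 * D / 2 ^ n ≤ 2 * D :=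
      div_le_self (by positivity) (one_le_pow₀ (by norm_num))
    have h3 := dist_triangle_right (picard b x g n t) (picard b x g 0 t) l
    have h4 : |picard b x g n t| ≤ |x| + dist (picard b x g n t) (picard b x g 0 t) := by
      rw [Real.dist_eq]
      exact (abs_add_le x (picard b x g n t - x)).trans' (by simp)
    linarith

/-- Existence for the integral equation `w t = x + ∫₀ᵗ b (w s - g s) ds`. -/
theorem picardLim_eq (hb : LipschitzWith K b) (hg : Monotone g) {t : ℝ} (ht : 0 ≤ t) :
    IntegrableOn (fun s => b (picardLim b x g s - g s)) (Ioc 0 t) ∧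
    picardLim b x g t = x + ∫ s in Ioc 0 t, b (picardLim b x g s - g s) := by
  obtain ⟨C, hC⟩ := exists_picard_bound (x := x) hb hg t
  have hm : Measurable (picardLim b x g) :=
    Measurable.limsup fun n => measurable_picard_path hb.continuous.measurable x hg.measurable n
  have hbd : ∀ s ∈ Icc 0 t, |picardLim b x g s| ≤ C := fun s hs =>
    le_of_tendsto (hC s hs).1.abs (Eventually.of_forall fun n => (hC s hs).2 n)
  refine ⟨integrableOn_comp_sub hb hg hm hbd, ?_⟩
  have h1 : Tendsto (fun n => picard b x g (n + 1) t) atTop (𝓝 (picardLim b x g t)) :=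
    (tendsto_add_atTop_iff_nat 1).2 (hC t ⟨ht, le_rfl⟩).1
  refine tendsto_nhds_unique h1 ?_
  simp only [picard]
  refine tendsto_const_nhds.add ?_
  refine tendsto_integral_of_dominated_convergence
    (fun _ => |b 0| + K * (C + (|g 0| + |g t|))) ?_ (by simp) ?_ ?_
  · exact fun n => (integrableOn_picard hb hg t n).1
  · intro n
    refine (ae_restrict_iff' measurableSet_Ioc).2 (ae_of_all _ fun s hs => ?_)
    have hs' := Ioc_subset_Icc_self hs
    have h3 := abs_le_of_monotone hg hs'
    have h4 := (hC s hs').2 n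
    refine (abs_le_of_lipschitz hb _).trans ?_
    gcongr
    exact (abs_sub _ _).trans (by gcongr)
  · refine (ae_restrict_iff' measurableSet_Ioc).2 (ae_of_all _ fun s hs => ?_)
    exact (hb.continuous.tendsto _).comp ((hC s (Ioc_subset_Icc_self hs)).1.sub tendsto_const_nhds)

end Picard

/-! ### Paths rebuilt from their values at a dense sequence of times -/

/-- A dense sequence of times. -/
noncomputable def denseTime : ℕ → ℝ≥0 := TopologicalSpace.denseSeq ℝ≥0

theorem exists_denseTime_between {s t : ℝ≥0} (h : s < t) : ∃ n, s < denseTime n ∧ denseTime n < t := by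
  obtain ⟨_, ⟨n, rfl⟩, hn⟩ := (TopologicalSpace.denseRange_denseSeq ℝ≥0).exists_between h
  exact ⟨n, hn⟩

/-- `a n` are the values at `denseTime n` of some nonnegative nondecreasing path. -/
def IsMonoSample (a : ℕ → ℝ) : Prop :=
  (∀ n, 0 ≤ a n) ∧ ∀ m n, denseTime m ≤ denseTime n → a m ≤ a n

/-- The left-continuous path with sample `a`. -/
noncomputable def lower (a : ℕ → ℝ) (t : ℝ≥0) : ℝ :=
  (⨆ n, if denseTime n < t then ENNReal.ofReal (a n) else 0).toReal

/-- The right-continuous path with sample `a`. -/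
noncomputable def upper (a : ℕ → ℝ) (t : ℝ≥0) : ℝ :=
  (⨅ n, if t < denseTime n then ENNReal.ofReal (a n) else ⊤).toReal

theorem measurableSet_isMonoSample : MeasurableSet {a | IsMonoSample a} := by
  have h : {a : ℕ → ℝ | IsMonoSample a} = (⋂ n, {a | 0 ≤ a n}) ∩
      ⋂ m, ⋂ n, ⋂ _ : denseTime m ≤ denseTime n, {a | a m ≤ a n} := by
    ext a; simp [IsMonoSample]
  rw [h]
  exact (MeasurableSet.iInter fun n => measurableSet_le measurable_const (measurable_pi_apply n)).inter
    (.iInter fun m => .iInter fun n => .iInter fun _ =>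
      measurableSet_le (measurable_pi_apply m) (measurable_pi_apply n))

theorem measurable_lower {A : Type*} [MeasurableSpace A] {f : A → ℕ → ℝ} {t : A → ℝ≥0}
    (hf : Measurable f) (ht : Measurable t) : Measurable fun z => lower (f z) (t z) := by
  refine (Measurable.iSup fun n => ?_).ennreal_toReal
  refine Measurable.ite (measurableSet_lt measurable_const ht) ?_ measurable_const
  exact ((measurable_pi_apply n).comp hf).ennreal_ofReal

theorem measurable_upper {A : Type*} [MeasurableSpace A] {f : A → ℕ → ℝ} {t : A → ℝ≥0}
    (hf : Measurable f) (ht : Measurable t) : Measurable fun z => upper (f z) (t z) := by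
  refine (Measurable.iInf fun n => ?_).ennreal_toReal
  refine Measurable.ite (measurableSet_lt ht measurable_const) ?_ measurable_const
  exact ((measurable_pi_apply n).comp hf).ennreal_ofReal

theorem lower_nonneg (a : ℕ → ℝ) (t : ℝ≥0) : 0 ≤ lower a t := ENNReal.toReal_nonneg

/-- No time precedes `0`, so only the default value `0` enters the supremum. -/
theorem lower_zero (a : ℕ → ℝ) : lower a 0 = 0 := by simp [lower]

theorem lower_le {a : ℕ → ℝ} {t : ℝ≥0} {c : ℝ} (hc : 0 ≤ c)
    (h : ∀ n, denseTime n < t → a n ≤ c) : lower a t ≤ c := by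
  refine ENNReal.toReal_le_of_le_ofReal hc (iSup_le fun n => ?_)
  split_ifs with hn
  · exact ENNReal.ofReal_le_ofReal (h n hn)
  · exact zero_le

theorem le_upper {a : ℕ → ℝ} {t : ℝ≥0} {c : ℝ} (h : ∀ n, t < denseTime n → c ≤ a n) : c ≤ upper a t := by
  obtain ⟨N, hN, -⟩ := exists_denseTime_between (lt_add_one t)
  rw [upper, ← ENNReal.ofReal_le_iff_le_toReal]
  · refine le_iInf fun m => ?_
    split_ifs with hm
    · exact ENNReal.ofReal_le_ofReal (h m hm)
    · exact le_top
  · exact ne_top_of_le_ne_top (ENNReal.ofReal_ne_top (r := a N))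
      (iInf_le_of_le N (by rw [if_pos hN]))

namespace IsMonoSample

variable {a : ℕ → ℝ} (ha : IsMonoSample a) {s t : ℝ≥0} {c : ℝ} {n : ℕ}
include ha

theorem le_lower (hn : denseTime n < t) : a n ≤ lower a t := by
  obtain ⟨N, hN, -⟩ := exists_denseTime_between (lt_add_one t)
  rw [lower, ← ENNReal.ofReal_le_iff_le_toReal]
  · exact le_iSup_of_le n (by rw [if_pos hn])
  · refine ne_top_of_le_ne_top (ENNReal.ofReal_ne_top (r := a N)) (iSup_le fun m => ?_)
    split_ifs with hm
    · exact ENNReal.ofReal_le_ofReal (ha.2 _ _ (hm.trans hN).le)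
    · exact zero_le

theorem upper_le (hn : t < denseTime n) : upper a t ≤ a n :=
  ENNReal.toReal_le_of_le_ofReal (ha.1 n) (iInf_le_of_le n (by rw [if_pos hn]))

theorem monotone_lower : Monotone (lower a) := fun _ t hst =>
  lower_le (lower_nonneg a t) fun _ hn => ha.le_lower (hn.trans_le hst)

theorem lower_leftCont (t : ℝ≥0) : ContinuousWithinAt (lower a) (Iic t) t := by
  refine tendsto_order.2 ⟨fun c hc => ?_, fun c hc => ?_⟩
  · by_cases h : ∃ n, denseTime n < t ∧ c < a n
    · obtain ⟨n, hn, hcn⟩ := h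
      have : Ioi (denseTime n) ∈ 𝓝[≤] t := mem_nhdsWithin_of_mem_nhds (Ioi_mem_nhds hn)
      filter_upwards [this] with u hu
      exact hcn.trans_le (ha.le_lower hu)
    · push Not at h
      have hc0 : c < 0 := by
        by_contra! h0
        exact absurd (lower_le h0 h) (not_le.2 hc)
      exact Eventually.of_forall fun u => hc0.trans_le (lower_nonneg a u)
  · filter_upwards [self_mem_nhdsWithin] with u hu
    exact (ha.monotone_lower hu).trans_lt hc

theorem upper_le_lower (hst : s < t) : upper a s ≤ lower a t := by
  obtain ⟨n, h1, h2⟩ := exists_denseTime_between hst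
  exact (ha.upper_le h1).trans (ha.le_lower h2)

/-- A squeeze: `upper a t ≤ lower a u` for `u > t`, and `lower a u ≤ a n` once `u < denseTime n`.
Hence the lump sums of a rebuilt strategy are `upper - lower`. -/
theorem tendsto_lower (t : ℝ≥0) : Tendsto (lower a) (𝓝[>] t) (𝓝 (upper a t)) := by
  refine tendsto_order.2 ⟨fun c hc => ?_, fun c hc => ?_⟩
  · filter_upwards [self_mem_nhdsWithin] with u hu
    exact hc.trans_le (ha.upper_le_lower hu)
  · obtain ⟨n, hn, hcn⟩ : ∃ n, t < denseTime n ∧ a n < c := by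
      by_contra! h
      exact absurd (le_upper h) (not_le.2 hc)
    have : Iio (denseTime n) ∈ 𝓝[>] t := mem_nhdsWithin_of_mem_nhds (Iio_mem_nhds hn)
    filter_upwards [this] with u hu
    exact (lower_le (ha.1 n) fun m hm => ha.2 _ _ (hm.trans hu).le).trans_lt hcn

theorem rightLim_lower (t : ℝ≥0) : Function.rightLim (lower a) t = upper a t :=
  rightLim_eq_of_tendsto (ha.tendsto_lower t)

end IsMonoSample

theorem isMonoSample_of_monotone {ℓ : ℝ≥0 → ℝ} (hm : Monotone ℓ) (h0 : 0 ≤ ℓ 0) :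
    IsMonoSample fun n => ℓ (denseTime n) :=
  ⟨fun _ => h0.trans (hm zero_le), fun _ _ h => hm h⟩

theorem lower_eq {ℓ : ℝ≥0 → ℝ} (hm : Monotone ℓ) (h0 : ℓ 0 = 0) {t : ℝ≥0}
    (hc : ContinuousWithinAt ℓ (Iic t) t) : lower (fun n => ℓ (denseTime n)) t = ℓ t := by
  have ha := isMonoSample_of_monotone hm h0.ge
  have h0t : 0 ≤ ℓ t := h0.ge.trans (hm zero_le)
  refine le_antisymm (lower_le h0t fun n hn => hm hn.le) ?_
  rcases eq_or_ne t 0 with rfl | ht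
  · rw [h0]; exact lower_nonneg _ _
  · have hpos : 0 < t := pos_iff_ne_zero.2 ht
    have : (𝓝[<] t).NeBot := nhdsLT_neBot_of_exists_lt ⟨0, hpos⟩
    refine le_of_tendsto (hc.mono Iio_subset_Iic_self : Tendsto ℓ (𝓝[<] t) (𝓝 (ℓ t))) ?_
    filter_upwards [self_mem_nhdsWithin] with s hs
    obtain ⟨n, h1, h2⟩ := exists_denseTime_between (show s < t from hs)
    exact (hm h1.le).trans (ha.le_lower h2)

theorem upper_eq {y : ℝ≥0 → ℝ} (hm : Monotone y) (h0 : 0 ≤ y 0) {t : ℝ≥0}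
    (hc : ContinuousWithinAt y (Ici t) t) : upper (fun n => y (denseTime n)) t = y t := by
  have ha := isMonoSample_of_monotone hm h0
  refine le_antisymm ?_ (le_upper fun n hn => hm hn.le)
  refine ge_of_tendsto (hc.mono Ioi_subset_Ici_self : Tendsto y (𝓝[>] t) (𝓝 (y t))) ?_
  filter_upwards [self_mem_nhdsWithin] with s hs
  obtain ⟨n, h1, h2⟩ := exists_denseTime_between (show t < s from hs)
  exact (ha.upper_le h1).trans (hm h2.le)

/-! ### Discounted Stieltjes integrals -/

/-- `∫ δ e^{-δ u} h(u ∧ τ) du` -/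
noncomputable def discounted (δ : ℝ) (h : ℝ≥0 → ℝ) (τ : ℝ≥0∞) : ℝ≥0∞ :=
  ∫⁻ u in Ioi (0 : ℝ), ENNReal.ofReal (δ * Real.exp (-(δ * u))) *
    ENNReal.ofReal (h (min (ENNReal.ofReal u) τ).toNNReal)

theorem lintegral_exp_Ici {δ : ℝ} (hδ : 0 < δ) (s : ℝ) :
    ∫⁻ u in Ici s, ENNReal.ofReal (δ * Real.exp (-(δ * u))) = ENNReal.ofReal (Real.exp (-(δ * s))) := by
  have h1 : (fun u => δ * Real.exp (-(δ * u))) = fun u => δ * Real.exp (-δ * u) := by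
    ext u; rw [neg_mul]
  have hi : IntegrableOn (fun u => δ * Real.exp (-(δ * u))) (Ioi s) := by
    rw [h1]; exact (integrableOn_exp_mul_Ioi (by linarith) s).const_mul δ
  rw [setLIntegral_congr Ioi_ae_eq_Ici.symm,
    ← ofReal_integral_eq_lintegral_ofReal hi (ae_of_all _ fun u => by positivity), h1,
    integral_const_mul, integral_exp_mul_Ioi (by linarith)]
  congr 1
  rw [neg_mul]
  field_simp

section Stieltjes

variable {ℓ : ℝ≥0 → ℝ} (hm : Monotone ℓ)
include hm

theorem rightLim_comp_toNNReal {v : ℝ} (hv : 0 ≤ v) :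
    Function.rightLim (ℓ ∘ Real.toNNReal) v = Function.rightLim ℓ v.toNNReal := by
  refine rightLim_eq_of_tendsto ((hm.tendsto_rightLim _).comp ?_)
  refine tendsto_nhdsWithin_iff.2 ⟨(continuous_real_toNNReal.tendsto v).mono_left nhdsWithin_le_nhds, ?_⟩
  filter_upwards [self_mem_nhdsWithin] with u hu
  exact (Real.toNNReal_lt_toNNReal_iff (hv.trans_lt hu)).2 hu

/-- The integrator is constant, equal to `ℓ 0`, on the negative axis, so its left limit at `0` is `ℓ
0` and a lump sum at time `0` is counted. -/
theorem stieltjes_Icc {v : ℝ} (hv : 0 ≤ v) :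
    stieltjes ℓ (Icc 0 v) = ENNReal.ofReal (Function.rightLim ℓ v.toNNReal - ℓ 0) := by
  have hmono : Monotone (ℓ ∘ Real.toNNReal) := hm.comp (fun _ _ hab => Real.toNNReal_mono hab)
  have hst : stieltjes ℓ = hmono.stieltjesFunction.measure := by
    rw [stieltjes, dif_pos hm]
  rw [hst, StieltjesFunction.measure_Icc, hmono.stieltjesFunction_eq, rightLim_comp_toNNReal hm hv]
  congr 2
  refine leftLim_eq_of_tendsto (tendsto_const_nhds.congr' ?_)
  filter_upwards [self_mem_nhdsWithin] with s (hs : s < 0)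
  rw [hmono.stieltjesFunction_eq]
  refine (rightLim_eq_of_tendsto (tendsto_const_nhds.congr' ?_)).symm
  filter_upwards [Ioo_mem_nhdsGT hs] with u hu
  simp [Real.toNNReal_of_nonpos hu.2.le]

/-- Write `e^{-δs} = ∫_s^∞ δ e^{-δu} du` and exchange the integrals; what remains is the mass of
`[0, u ∧ τ]`. In this form the return is easy to bound, to translate and to measure. -/
theorem setLIntegral_stieltjes {δ : ℝ} (hδ : 0 < δ) (τ : ℝ≥0∞) :
    ∫⁻ s in {s : ℝ | 0 ≤ s ∧ ENNReal.ofReal s ≤ τ}, ENNReal.ofReal (Real.exp (-(δ * s)))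
      ∂(stieltjes ℓ) = discounted δ (fun t => Function.rightLim ℓ t - ℓ 0) τ := by
  have hmono : Monotone (ℓ ∘ Real.toNNReal) := hm.comp (fun _ _ hab => Real.toNNReal_mono hab)
  have hst : stieltjes ℓ = hmono.stieltjesFunction.measure := by
    rw [stieltjes, dif_pos hm]
  have hsf : SFinite (stieltjes ℓ) := by rw [hst]; infer_instance
  set A := {s : ℝ | 0 ≤ s ∧ ENNReal.ofReal s ≤ τ} with hA
  have hAm : MeasurableSet A :=
    measurableSet_Ici.inter (measurableSet_le ENNReal.measurable_ofReal measurable_const)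
  set φ : ℝ → ℝ≥0∞ := fun u => ENNReal.ofReal (δ * Real.exp (-(δ * u))) with hφ
  have hφm : Measurable φ := by fun_prop
  calc ∫⁻ s in A, ENNReal.ofReal (Real.exp (-(δ * s))) ∂(stieltjes ℓ)
      = ∫⁻ s in A, (∫⁻ u, (Ici s).indicator φ u) ∂(stieltjes ℓ) := by
        refine lintegral_congr fun s => ?_
        rw [lintegral_indicator measurableSet_Ici, lintegral_exp_Ici hδ]
    _ = ∫⁻ u, ∫⁻ s in A, (Ici s).indicator φ u ∂(stieltjes ℓ) := by
        refine lintegral_lintegral_swap (Measurable.aemeasurable ?_)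
        have : Function.uncurry (fun (s : ℝ) (u : ℝ) => (Ici s).indicator φ u)
            = {q : ℝ × ℝ | q.1 ≤ q.2}.indicator fun q => φ q.2 := by
          ext ⟨s, u⟩; simp [indicator]
        rw [this]
        exact (hφm.comp measurable_snd).indicator (measurableSet_le measurable_fst measurable_snd)
    _ = ∫⁻ u, φ u * stieltjes ℓ (A ∩ Iic u) := by
        refine lintegral_congr fun u => ?_
        have : (fun s => (Ici s).indicator φ u) = (Iic u).indicator fun _ => φ u := by
          ext s; simp [indicator]
        rw [this, lintegral_indicator measurableSet_Iic, lintegral_const,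
          Measure.restrict_restrict measurableSet_Iic, Measure.restrict_apply_univ, inter_comm]
    _ = ∫⁻ u in Ici 0, φ u * stieltjes ℓ (A ∩ Iic u) := by
        rw [← lintegral_indicator measurableSet_Ici]
        refine lintegral_congr fun u => ?_
        by_cases hu : u ∈ Ici (0 : ℝ)
        · rw [indicator_of_mem hu]
        · rw [indicator_of_notMem hu]
          have : A ∩ Iic u = ∅ := by
            ext s
            simp only [mem_inter_iff, mem_Iic, mem_empty_iff_false, iff_false, not_and]
            intro hs hsu
            exact hu (hs.1.trans hsu)
          simp [this]
    _ = ∫⁻ u in Ioi 0, φ u * stieltjes ℓ (A ∩ Iic u) :=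
        setLIntegral_congr Ioi_ae_eq_Ici.symm
    _ = _ := by
        refine setLIntegral_congr_fun measurableSet_Ioi fun u (hu : 0 < u) => ?_
        set v := (min (ENNReal.ofReal u) τ).toNNReal with hv
        have hv' : (v : ℝ≥0∞) = min (ENNReal.ofReal u) τ :=
          ENNReal.coe_toNNReal (ne_top_of_le_ne_top ENNReal.ofReal_ne_top (min_le_left _ _))
        have : A ∩ Iic u = Icc 0 (v : ℝ) := by
          ext s
          simp only [hA, mem_inter_iff, mem_ofPred_eq, mem_Iic, mem_Icc, and_assoc]
          refine and_congr_right fun hs => ?_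
          rw [← ENNReal.ofReal_le_ofReal_iff v.coe_nonneg, ENNReal.ofReal_coe_nnreal, hv', le_min_iff,
            ENNReal.ofReal_le_ofReal_iff hu.le, and_comm]
        rw [this, stieltjes_Icc hm v.coe_nonneg, Real.toNNReal_coe]

end Stieltjes

/-! ### The reserve equation along one path -/

theorem drift_eq (p r α z : ℝ) : drift p r α z = p + r * max z 0 + α * min z 0 := by
  rw [drift]
  split_ifs with h
  · rw [max_eq_left h, min_eq_right h]; ring
  · rw [max_eq_right (not_le.1 h).le, min_eq_left (not_le.1 h).le]; ring

section Deterministic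

variable {p r α : ℝ} (hp : 0 < p) (hr : 0 < r) (hα : r < α)

include hr hα in
theorem lipschitzWith_drift : LipschitzWith α.toNNReal (drift p r α) := by
  have hα0 : 0 < α := hr.trans hα
  refine LipschitzWith.of_dist_le_mul fun a b => ?_
  rw [Real.coe_toNNReal α hα0.le, Real.dist_eq, Real.dist_eq]
  wlog hab : b ≤ a generalizing a b
  · rw [abs_sub_comm, abs_sub_comm a b]; exact this b a (not_le.1 hab).le
  rw [abs_of_nonneg (sub_nonneg.2 hab)]
  simp only [drift]
  rw [abs_le]
  split_ifs with h1 h2 h2 <;> constructor <;> nlinarith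

include hr hα in
-- The debit line `α z + p` dominates the drift because `r < α`. It vanishes at `-p/α`, which is why
-- no reserve climbs back from there.
theorem drift_le_debit (z : ℝ) : drift p r α z ≤ α * max (z + p / α) 0 := by
  have hα0 : 0 < α := hr.trans hα
  have h : α * (z + p / α) = α * z + p := by field_simp
  have : drift p r α z ≤ α * z + p := by
    rw [drift]; split_ifs <;> nlinarith
  calc _ ≤ α * (z + p / α) := h ▸ this
    _ ≤ _ := by gcongr; exact le_max_left _ _

include hr hα in
theorem drift_le_credit (z : ℝ) : drift p r α z ≤ p + r * max z 0 := by
  rw [drift_eq]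
  have : α * min z 0 ≤ 0 :=
    mul_nonpos_of_nonneg_of_nonpos (hr.trans hα).le (min_le_right _ _)
  linarith

/-- `ρ` solves the reserve equation with cumulative outflow `g`. -/
def IsReservePath (p r α x : ℝ) (g ρ : ℝ≥0 → ℝ) : Prop :=
  ∀ t : ℝ≥0, IntervalIntegrable (fun s : ℝ => drift p r α (ρ s.toNNReal)) volume 0 t ∧
    ρ t = x + (∫ s in (0 : ℝ)..t, drift p r α (ρ s.toNNReal)) - g t

/-- The solution of the reserve equation for a nondecreasing outflow. -/
noncomputable def reserveOf (p r α x : ℝ) (g : ℝ≥0 → ℝ) (t : ℝ≥0) : ℝ :=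
  picardLim (drift p r α) x (fun s => g s.toNNReal) t - g t

include hr hα in
-- Adding the outflow removes the jumps: `w = ρ + g` solves `w t = x + ∫₀ᵗ b (w - g)`, to which
-- Picard iteration applies.
theorem isReservePath_reserveOf (x : ℝ) {g : ℝ≥0 → ℝ} (hg : Monotone g) :
    IsReservePath p r α x g (reserveOf p r α x g) := by
  intro t
  have hg' : Monotone fun s : ℝ => g s.toNNReal := hg.comp fun _ _ h => Real.toNNReal_mono h
  obtain ⟨h1, h2⟩ := picardLim_eq (x := x) (lipschitzWith_drift (p := p) hr hα) hg' t.coe_nonneg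
  have hcongr : EqOn (fun s : ℝ => drift p r α (reserveOf p r α x g s.toNNReal))
      (fun s => drift p r α (picardLim (drift p r α) x (fun s => g s.toNNReal) s - g s.toNNReal))
      (Ioc 0 (t : ℝ)) := by
    intro s hs
    simp only [reserveOf]
    rw [Real.coe_toNNReal s hs.1.le]
  constructor
  · rw [intervalIntegrable_iff_integrableOn_Ioc_of_le t.coe_nonneg]
    exact h1.congr_fun hcongr.symm measurableSet_Ioc
  · rw [intervalIntegral.integral_of_le t.coe_nonneg, setIntegral_congr_fun measurableSet_Ioc hcongr,
      ← h2, reserveOf]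

variable {x : ℝ} {g ρ ρ' : ℝ≥0 → ℝ}

include hr hα in
-- Grönwall is applied to the difference of the two drifts, which is at most `α` times its own
-- integral; only integrability is needed.
theorem IsReservePath.unique (h : IsReservePath p r α x g ρ) (h' : IsReservePath p r α x g ρ') :
    ρ = ρ' := by
  have hα0 : 0 < α := hr.trans hα
  set f : ℝ → ℝ := fun s => |drift p r α (ρ s.toNNReal) - drift p r α (ρ' s.toNNReal)| with hf
  have hfi : ∀ t : ℝ≥0, IntervalIntegrable f volume 0 t := fun t => ((h t).1.sub (h' t).1).abs
  have hdiff : ∀ t : ℝ≥0, |ρ t - ρ' t| ≤ ∫ s in (0 : ℝ)..t, f s := by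
    intro t
    have : ρ t - ρ' t
        = ∫ s in (0 : ℝ)..t, (drift p r α (ρ s.toNNReal) - drift p r α (ρ' s.toNNReal)) := by
      rw [intervalIntegral.integral_sub (h t).1 (h' t).1, (h t).2, (h' t).2]; ring
    rw [this]
    exact intervalIntegral.abs_integral_le_integral_abs t.coe_nonneg
  have hle : ∀ t : ℝ≥0, f t ≤ 0 + α * ∫ s in (0 : ℝ)..t, f s := by
    intro t
    have h1 := (lipschitzWith_drift (p := p) hr hα).dist_le_mul (ρ t) (ρ' t)
    rw [Real.coe_toNNReal α hα0.le, Real.dist_eq, Real.dist_eq] at h1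
    simp only [hf, Real.toNNReal_coe, zero_add]
    exact h1.trans (by gcongr; exact hdiff t)
  have hzero : ∀ t : ℝ≥0, f t ≤ 0 := by
    intro t
    have := le_mul_exp_of_le_add_integral (a := 0) t.coe_nonneg hα0.le (hfi t)
      (fun s hs => hle ⟨s, hs.1⟩)
    simpa using this
  ext t
  have h0 : ∫ s in (0 : ℝ)..t, f s = 0 := by
    rw [intervalIntegral.integral_congr (g := fun _ => 0)]
    · simp
    · intro s hs
      rw [uIcc_of_le t.coe_nonneg] at hs
      exact le_antisymm (hzero ⟨s, hs.1⟩) (abs_nonneg _)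
  have := hdiff t
  rw [h0] at this
  exact sub_eq_zero.1 (abs_nonpos_iff.1 this)

theorem IsReservePath.eq_add_integral (h : IsReservePath p r α x g ρ) (s t : ℝ≥0) :
    ρ t = ρ s + (∫ u in (s : ℝ)..t, drift p r α (ρ u.toNNReal)) - (g t - g s) := by
  rw [(h t).2, (h s).2, ← intervalIntegral.integral_add_adjacent_intervals (h s).1
    ((h s).1.symm.trans (h t).1)]
  ring

theorem IsReservePath.intervalIntegrable_max (h : IsReservePath p r α x g ρ) (t : ℝ≥0) :
    IntervalIntegrable (fun s : ℝ => max (drift p r α (ρ s.toNNReal)) 0) volume 0 t := by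
  have := (h t).1
  rw [intervalIntegrable_iff] at this ⊢
  exact this.pos_part

include hr hα in
/-- A reserve at or below the critical level never recovers. -/
theorem IsReservePath.le_of_le (h : IsReservePath p r α x g ρ) (hg : Monotone g) {s t : ℝ≥0}
    (hst : s ≤ t) (hs : ρ s ≤ -(p / α)) : ρ t ≤ -(p / α) := by
  have hα0 : 0 < α := hr.trans hα
  -- `f` is the positive part of the drift after `s`. There `ρ + p/α ≤ ∫ f` and the drift is at most
  -- `α (ρ + p/α)⁺`, so `f` is at most `α` times its own integral and Grönwall forces `f = 0`.
  set f : ℝ → ℝ := (Ioi (s : ℝ)).indicator fun u => max (drift p r α (ρ u.toNNReal)) 0 with hf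
  have hf0 : ∀ u, 0 ≤ f u := fun u => indicator_nonneg (fun _ _ => le_max_right _ _) u
  have hfi : ∀ t : ℝ≥0, IntervalIntegrable f volume 0 t := by
    intro t
    have := h.intervalIntegrable_max t
    rw [intervalIntegrable_iff] at this ⊢
    exact this.indicator measurableSet_Ioi
  have hI : ∀ v : ℝ≥0, s ≤ v → ρ v + p / α ≤ ∫ u in (0 : ℝ)..v, f u := by
    intro v hsv
    have hsv' : (s : ℝ) ≤ v := hsv
    have h1 := h.eq_add_integral s v
    have h2 := hg hsv
    have h3 : (∫ u in (s : ℝ)..v, drift p r α (ρ u.toNNReal)) ≤ ∫ u in (s : ℝ)..v, f u := by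
      rw [intervalIntegral.integral_of_le hsv', intervalIntegral.integral_of_le hsv']
      refine setIntegral_mono_on ?_ ?_ measurableSet_Ioc fun u hu => ?_
      · exact (intervalIntegrable_iff_integrableOn_Ioc_of_le hsv').1 ((h s).1.symm.trans (h v).1)
      · exact (intervalIntegrable_iff_integrableOn_Ioc_of_le hsv').1
          ((hfi s).symm.trans (hfi v))
      · rw [hf, indicator_of_mem (show u ∈ Ioi (s : ℝ) from hu.1)]
        exact le_max_left _ _
    have h4 : (∫ u in (s : ℝ)..v, f u) ≤ ∫ u in (0 : ℝ)..v, f u := by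
      rw [← intervalIntegral.integral_add_adjacent_intervals (hfi s) ((hfi s).symm.trans (hfi v))]
      have := intervalIntegral.integral_nonneg (μ := volume) s.coe_nonneg fun u _ => hf0 u
      linarith
    linarith
  have hle : ∀ v : ℝ≥0, f v ≤ 0 + α * ∫ u in (0 : ℝ)..v, f u := by
    intro v
    have h0 : 0 ≤ ∫ u in (0 : ℝ)..v, f u :=
      intervalIntegral.integral_nonneg (μ := volume) v.coe_nonneg fun u _ => hf0 u
    rw [zero_add]
    by_cases hv : (v : ℝ) ∈ Ioi (s : ℝ)
    · rw [hf, indicator_of_mem hv, ← hf, Real.toNNReal_coe]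
      refine max_le ((drift_le_debit hr hα _).trans ?_) (by positivity)
      gcongr
      exact max_le (hI v (le_of_lt hv)) h0
    · rw [hf, indicator_of_notMem hv, ← hf]
      positivity
  have hzero : ∀ v : ℝ≥0, f v ≤ 0 := by
    intro v
    have := le_mul_exp_of_le_add_integral (a := 0) v.coe_nonneg hα0.le (hfi v)
      (fun u hu => hle ⟨u, hu.1⟩)
    simpa using this
  have h0 : ∫ u in (0 : ℝ)..t, f u = 0 := by
    rw [intervalIntegral.integral_congr (g := fun _ => 0)]
    · simp
    · intro u hu
      rw [uIcc_of_le t.coe_nonneg] at hu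
      exact le_antisymm (hzero ⟨u, hu.1⟩) (hf0 u)
  have := hI t hst
  linarith

include hp hr hα in
/-- Without claims and dividends the reserve grows at most exponentially at rate `r`. -/
theorem IsReservePath.add_le (h : IsReservePath p r α x g ρ) (hg : ∀ t, 0 ≤ g t) (t : ℝ≥0) :
    ρ t + g t ≤ (max x 0 + p / r) * Real.exp (r * t) := by
  set f : ℝ → ℝ := fun s => max (drift p r α (ρ s.toNNReal)) 0 with hf
  have hfi := h.intervalIntegrable_max
  have hI : ∀ v : ℝ≥0, ρ v + g v ≤ max x 0 + ∫ u in (0 : ℝ)..v, f u := by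
    intro v
    have h1 := (h v).2
    have h3 : (∫ u in (0 : ℝ)..v, drift p r α (ρ u.toNNReal)) ≤ ∫ u in (0 : ℝ)..v, f u :=
      intervalIntegral.integral_mono_on v.coe_nonneg (h v).1 (hfi v) fun u _ => le_max_left _ _
    have := le_max_left x 0
    linarith
  have hle : ∀ v : ℝ≥0, f v ≤ (p + r * max x 0) + r * ∫ u in (0 : ℝ)..v, f u := by
    intro v
    have h0 : 0 ≤ ∫ u in (0 : ℝ)..v, f u :=
      intervalIntegral.integral_nonneg (μ := volume) v.coe_nonneg fun u _ => le_max_right _ _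
    have hx0 : 0 ≤ max x 0 := le_max_right _ _
    simp only [hf, Real.toNNReal_coe]
    refine max_le ((drift_le_credit hr hα _).trans ?_) (by positivity)
    have : max (ρ v) 0 ≤ max x 0 + ∫ u in (0 : ℝ)..v, f u :=
      max_le ((le_add_of_nonneg_right (hg v)).trans (hI v)) (by positivity)
    nlinarith
  have hexp : ∀ v : ℝ≥0, f v ≤ (p + r * max x 0) * Real.exp (r * v) := fun v =>
    le_mul_exp_of_le_add_integral v.coe_nonneg hr.le (hfi v) fun u hu => hle ⟨u, hu.1⟩
  have hint : (∫ u in (0 : ℝ)..t, f u) ≤ ∫ u in (0 : ℝ)..t, (p + r * max x 0) * Real.exp (r * u) :=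
    intervalIntegral.integral_mono_on t.coe_nonneg (hfi t)
      ((by fun_prop : Continuous fun u => (p + r * max x 0) * Real.exp (r * u)).intervalIntegrable _ _)
      fun u hu => hexp ⟨u, hu.1⟩
  -- The undisturbed reserve from `max x 0` is `(max x 0 + p/r) e^{rs} - p/r`; the final bound drops
  -- the `-p/r`.
  have hd : ∀ s ∈ uIcc 0 (t : ℝ), HasDerivAt (fun s : ℝ => (max x 0 + p / r) * Real.exp (r * s))
      ((p + r * max x 0) * Real.exp (r * s)) s := by
    intro s _
    have := (((hasDerivAt_id s).const_mul r).exp).const_mul (max x 0 + p / r)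
    exact this.congr_deriv (by simp only [id]; field_simp; ring)
  rw [intervalIntegral.integral_eq_sub_of_hasDerivAt hd
    ((by fun_prop : Continuous fun u => (p + r * max x 0) * Real.exp (r * u)).intervalIntegrable _ _)]
    at hint
  have := hI t
  have : 0 < p / r := by positivity
  simp only [mul_zero, Real.exp_zero, mul_one] at hint
  linarith

/-- The ruin time computed from the reserve at the times `denseTime n`. -/
noncomputable def sampledRuin (p α : ℝ) (ρ : ℝ≥0 → ℝ) : ℝ≥0∞ :=
  ⨅ n, if ρ (denseTime n) ≤ -(p / α) then (denseTime n : ℝ≥0∞) else ⊤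

theorem lt_of_lt_ruinTime {t : ℝ≥0} (h : (t : ℝ≥0∞) < ruinTime p α ρ) : -(p / α) < ρ t := by
  by_contra! h'
  exact absurd (iInf₂_le (f := fun (s : ℝ≥0) (_ : ρ s ≤ -(p / α)) => (s : ℝ≥0∞)) t h') (not_le.2 h)

include hr hα in
-- A reserve that has reached the critical level stays at or below it, so ruin is visible at every
-- later time of the dense sequence. A countable infimum then suffices, which makes the ruin time
-- measurable.
theorem IsReservePath.ruinTime_eq (h : IsReservePath p r α x g ρ) (hg : Monotone g) :
    ruinTime p α ρ = sampledRuin p α ρ := by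
  refine le_antisymm (le_iInf fun n => ?_) (le_iInf₂ fun t ht => ?_)
  · split_ifs with hn
    · exact iInf₂_le (f := fun (s : ℝ≥0) (_ : ρ s ≤ -(p / α)) => (s : ℝ≥0∞)) _ hn
    · exact le_top
  · refine le_of_forall_gt_imp_ge_of_dense fun c hc => ?_
    obtain ⟨c', hc1, hc2⟩ := ENNReal.lt_iff_exists_nnreal_btwn.1 hc
    obtain ⟨n, h1, h2⟩ := exists_denseTime_between (ENNReal.coe_lt_coe.1 hc1)
    refine (iInf_le_of_le n ?_).trans hc2.le
    rw [if_pos (h.le_of_le hr hα hg h1.le ht)]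
    exact ENNReal.coe_le_coe.2 h2.le

variable {y ℓ : ℝ≥0 → ℝ}

/-- Before ruin no lump sum can take the reserve below the critical level. -/
theorem IsReservePath.jump_le (h : IsReservePath p r α x (fun t => y t + ℓ t) ρ)
    (hℓ : Monotone ℓ) {t : ℝ≥0} (hy : ContinuousWithinAt y (Ici t) t)
    (ht : (t : ℝ≥0∞) < ruinTime p α ρ) :
    Function.rightLim ℓ t - ℓ t ≤ ρ t + p / α := by
  have hcont : Tendsto (fun s : ℝ≥0 => ∫ u in (0 : ℝ)..s, drift p r α (ρ u.toNNReal)) (𝓝[>] t)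
      (𝓝 (∫ u in (0 : ℝ)..t, drift p r α (ρ u.toNNReal))) := by
    have h1 := intervalIntegral.continuousOn_primitive_interval (μ := volume) (a := 0)
      (b := ((t + 1 : ℝ≥0) : ℝ)) (f := fun u => drift p r α (ρ u.toNNReal))
      (by rw [uIcc_of_le (t + 1).coe_nonneg]
          exact (intervalIntegrable_iff_integrableOn_Icc_of_le (t + 1).coe_nonneg).1 (h (t + 1)).1)
    rw [uIcc_of_le (t + 1).coe_nonneg] at h1
    have h2 := h1 (t : ℝ) ⟨t.coe_nonneg, by simp⟩
    refine Tendsto.comp (show Tendsto _ _ _ from h2) (tendsto_nhdsWithin_iff.2 ⟨?_, ?_⟩)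
    · exact (NNReal.continuous_coe.tendsto t).mono_left nhdsWithin_le_nhds
    · have : Iio (t + 1) ∈ 𝓝[>] t := mem_nhdsWithin_of_mem_nhds (Iio_mem_nhds (lt_add_one t))
      filter_upwards [this] with s hs
      exact ⟨s.coe_nonneg, NNReal.coe_le_coe.2 (le_of_lt hs)⟩
  -- As the claims are right-continuous, the right limit of `ρ` at `t` is `ρ t` minus the lump sum;
  -- strictly before ruin it cannot lie below the critical level.
  have hlim : Tendsto ρ (𝓝[>] t) (𝓝 (x + (∫ u in (0 : ℝ)..t, drift p r α (ρ u.toNNReal))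
      - (y t + Function.rightLim ℓ t))) := by
    have hy' : Tendsto y (𝓝[>] t) (𝓝 (y t)) := hy.mono Ioi_subset_Ici_self
    refine ((tendsto_const_nhds.add hcont).sub (hy'.add (hℓ.tendsto_rightLim t))).congr fun s => ?_
    rw [(h s).2]
  have hge : -(p / α) ≤ x + (∫ u in (0 : ℝ)..t, drift p r α (ρ u.toNNReal))
      - (y t + Function.rightLim ℓ t) := by
    refine ge_of_tendsto hlim ?_
    obtain ⟨c, hc1, hc2⟩ := ENNReal.lt_iff_exists_nnreal_btwn.1 ht
    have : Iio c ∈ 𝓝[>] t := mem_nhdsWithin_of_mem_nhds (Iio_mem_nhds (ENNReal.coe_lt_coe.1 hc1))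
    filter_upwards [this] with s hs
    exact (lt_of_lt_ruinTime ((ENNReal.coe_lt_coe.2 hs).trans hc2)).le
  have := (h t).2
  linarith

include hp hr hα in
/-- A bound on the dividends paid up to ruin. -/
theorem IsReservePath.rightLim_le (h : IsReservePath p r α x (fun t => y t + ℓ t) ρ)
    (hy : ∀ t, 0 ≤ y t) (hℓ : Monotone ℓ) (hℓ0 : ℓ 0 = 0)
    (hℓc : ∀ t, ContinuousWithinAt ℓ (Iic t) t) {t : ℝ≥0} (ht : (t : ℝ≥0∞) ≤ ruinTime p α ρ)
    (hlump : Function.rightLim ℓ t - ℓ t ≤ max (ρ t + p / α) 0) :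
    Function.rightLim ℓ t ≤ (max x 0 + p / r) * Real.exp (r * t) + p / α := by
  have hα0 : 0 < α := hr.trans hα
  have hpα : 0 < p / α := by positivity
  have hℓn : ∀ t, 0 ≤ ℓ t := fun t => hℓ0.ge.trans (hℓ zero_le)
  have hbd := h.add_le hp hr hα fun t => add_nonneg (hy t) (hℓn t)
  have hA : 0 ≤ max x 0 + p / r := by have := le_max_right x 0; positivity
  have hℓt : ℓ t ≤ (max x 0 + p / r) * Real.exp (r * t) + p / α := by
    -- The reserve is known to exceed `-p/α` only strictly before ruin, so `ℓ t` is bounded through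
    -- its left limit. This is the source of the extra `p/α`.
    rcases eq_or_ne t 0 with rfl | ht0
    · rw [hℓ0]; positivity
    · have hpos : 0 < t := pos_iff_ne_zero.2 ht0
      have : (𝓝[<] t).NeBot := nhdsLT_neBot_of_exists_lt ⟨0, hpos⟩
      refine le_of_tendsto ((hℓc t).mono Iio_subset_Iic_self : Tendsto ℓ (𝓝[<] t) (𝓝 (ℓ t))) ?_
      filter_upwards [self_mem_nhdsWithin] with s hs
      have h1 := lt_of_lt_ruinTime ((ENNReal.coe_lt_coe.2 hs).trans_le ht)
      have h2 := hbd s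
      have h3 : (max x 0 + p / r) * Real.exp (r * s) ≤ (max x 0 + p / r) * Real.exp (r * t) := by
        have : (s : ℝ) ≤ t := NNReal.coe_le_coe.2 (le_of_lt hs)
        gcongr
      have := hy s
      linarith
  -- Either the lump sum is at most `ρ t + p/α` and the bound on `ρ t + ℓ t` absorbs it, or a claim
  -- has caused ruin and there is no lump sum.
  rcases max_cases (ρ t + p / α) 0 with ⟨h1, -⟩ | ⟨h1, -⟩
  · have := hbd t
    have := hy t
    linarith
  · linarith

end Deterministic

/-! ### Admissible paths and their samples -/

/-- The defining properties of a claim path `y`, an admissible dividend path `ℓ` and the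
controlled reserve path `ρ` started at `x`. -/
structure AdmissiblePath (p r α x : ℝ) (y ℓ ρ : ℝ≥0 → ℝ) : Prop where
  claims_mono : Monotone y
  claims_zero : y 0 = 0
  claims_rightCont : ∀ t, ContinuousWithinAt y (Ici t) t
  mono : Monotone ℓ
  zero : ℓ 0 = 0
  leftCont : ∀ t, ContinuousWithinAt ℓ (Iic t) t
  reserve : IsReservePath p r α x (fun t => y t + ℓ t) ρ
  lump_le : ∀ t : ℝ≥0, (t : ℝ≥0∞) ≤ ruinTime p α ρ →
    Function.rightLim ℓ t - ℓ t ≤ max (ρ t + p / α) 0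

/-- The discounted dividends along one path. -/
noncomputable def pathReturn (p α δ : ℝ) (ℓ ρ : ℝ≥0 → ℝ) : ℝ≥0∞ :=
  ∫⁻ s in {s : ℝ | 0 ≤ s ∧ ENNReal.ofReal s ≤ ruinTime p α ρ},
    ENNReal.ofReal (Real.exp (-(δ * s))) ∂(stieltjes ℓ)

/-- The reserve belonging to samples of a claim path and a dividend path. -/
noncomputable def sampleReserve (p r α x : ℝ) (q : (ℕ → ℝ) × (ℕ → ℝ)) : ℝ≥0 → ℝ :=
  reserveOf p r α x fun t => upper q.1 t + lower q.2 t

/-- The discounted dividends belonging to samples of a claim path and a dividend path. -/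
noncomputable def sampleReturn (p r α δ x : ℝ) (q : (ℕ → ℝ) × (ℕ → ℝ)) : ℝ≥0∞ :=
  discounted δ (upper q.2) (sampledRuin p α (sampleReserve p r α x q))

/-- The samples of admissible paths. A lump sum is restricted only at the time of ruin, because
the other restrictions hold automatically. -/
def IsAdmissibleSample (p r α x : ℝ) (q : (ℕ → ℝ) × (ℕ → ℝ)) : Prop :=
  IsMonoSample q.2 ∧ (sampledRuin p α (sampleReserve p r α x q) ≠ ⊤ →
    upper q.2 (sampledRuin p α (sampleReserve p r α x q)).toNNReal
      - lower q.2 (sampledRuin p α (sampleReserve p r α x q)).toNNReal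
    ≤ max (sampleReserve p r α x q (sampledRuin p α (sampleReserve p r α x q)).toNNReal + p / α) 0)

section Measurability

variable {p r α : ℝ} (hr : 0 < r) (hα : r < α)
include hr hα

theorem measurable_sampleReserve (x : ℝ) {A : Type*} [MeasurableSpace A]
    {f : A → (ℕ → ℝ) × (ℕ → ℝ)} {t : A → ℝ≥0} (hf : Measurable f) (ht : Measurable t) :
    Measurable fun z => sampleReserve p r α x (f z) (t z) := by
  have hg : Measurable fun q : A × ℝ =>
      upper (f q.1).1 q.2.toNNReal + lower (f q.1).2 q.2.toNNReal :=
    (measurable_upper (by fun_prop) (by fun_prop)).add (measurable_lower (by fun_prop) (by fun_prop))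
  have h1 := measurable_picardLim (A := A)
    (g := fun z s => upper (f z).1 s.toNNReal + lower (f z).2 s.toNNReal)
    (lipschitzWith_drift (p := p) hr hα).continuous.measurable x hg (t := fun z => (t z : ℝ))
    (by fun_prop)
  have h2 : Measurable fun z : A => upper (f z).1 (t z) + lower (f z).2 (t z) :=
    (measurable_upper (by fun_prop) ht).add (measurable_lower (by fun_prop) ht)
  exact h1.sub h2

theorem measurable_sampledRuin (x : ℝ) :
    Measurable fun q : (ℕ → ℝ) × (ℕ → ℝ) => sampledRuin p α (sampleReserve p r α x q) :=
  Measurable.iInf fun _ => Measurable.ite (measurableSet_le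
    (measurable_sampleReserve hr hα x measurable_id measurable_const) measurable_const)
    measurable_const measurable_const

theorem measurable_sampleReturn (δ x : ℝ) : Measurable (sampleReturn p r α δ x) := by
  have h1 : Measurable fun z : ((ℕ → ℝ) × (ℕ → ℝ)) × ℝ =>
      sampledRuin p α (sampleReserve p r α x z.1) :=
    (measurable_sampledRuin hr hα x).comp measurable_fst
  have h3 : Measurable fun z : ((ℕ → ℝ) × (ℕ → ℝ)) × ℝ => upper z.1.2
      (min (ENNReal.ofReal z.2) (sampledRuin p α (sampleReserve p r α x z.1))).toNNReal :=
    measurable_upper (by fun_prop) (by fun_prop)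
  have h4 : Measurable fun z : ((ℕ → ℝ) × (ℕ → ℝ)) × ℝ =>
    ENNReal.ofReal (δ * Real.exp (-(δ * z.2))) * ENNReal.ofReal (upper z.1.2
      (min (ENNReal.ofReal z.2) (sampledRuin p α (sampleReserve p r α x z.1))).toNNReal) :=
    Measurable.mul (by fun_prop) h3.ennreal_ofReal
  exact h4.lintegral_prod_right'

theorem measurableSet_isAdmissibleSample (x : ℝ) :
    MeasurableSet {q | IsAdmissibleSample p r α x q} := by
  have hT := measurable_sampledRuin (p := p) hr hα x
  have hT' := hT.ennreal_toNNReal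
  refine MeasurableSet.inter (measurableSet_isMonoSample.preimage measurable_snd) ?_
  refine MeasurableSet.imp (measurableSet_eq_fun hT measurable_const).compl ?_
  exact measurableSet_le
    ((measurable_upper measurable_snd hT').sub (measurable_lower measurable_snd hT'))
    (((measurable_sampleReserve (p := p) hr hα x measurable_id hT').add_const _).max
      measurable_const)

end Measurability

section Sampling

variable {p r α δ x : ℝ} {y ℓ ρ : ℝ≥0 → ℝ}

theorem AdmissiblePath.pathReturn_eq (h : AdmissiblePath p r α x y ℓ ρ) (hδ : 0 < δ) :
    pathReturn p α δ ℓ ρ = discounted δ (Function.rightLim ℓ) (ruinTime p α ρ) := by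
  simp [pathReturn, setLIntegral_stieltjes h.mono hδ, h.zero]

variable (hr : 0 < r) (hα : r < α)
include hr hα

/-- `upper` and `lower` recover the claim and dividend paths, so both sides solve the same reserve
equation, whose solution is unique. -/
theorem AdmissiblePath.sampleReserve_eq (h : AdmissiblePath p r α x y ℓ ρ) :
    sampleReserve p r α x (fun n => y (denseTime n), fun n => ℓ (denseTime n)) = ρ := by
  have hg : (fun t => upper (fun n => y (denseTime n)) t + lower (fun n => ℓ (denseTime n)) t)
      = fun t => y t + ℓ t := by
    ext t
    rw [upper_eq h.claims_mono h.claims_zero.ge (h.claims_rightCont t),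
      lower_eq h.mono h.zero (h.leftCont t)]
  rw [sampleReserve]
  dsimp only
  rw [hg]
  exact (isReservePath_reserveOf hr hα x (h.claims_mono.add h.mono)).unique hr hα h.reserve

theorem AdmissiblePath.sample (h : AdmissiblePath p r α x y ℓ ρ) (hδ : 0 < δ) :
    IsAdmissibleSample p r α x (fun n => y (denseTime n), fun n => ℓ (denseTime n)) ∧
    sampleReturn p r α δ x (fun n => y (denseTime n), fun n => ℓ (denseTime n))
      = pathReturn p α δ ℓ ρ := by
  have ha : IsMonoSample fun n => ℓ (denseTime n) := isMonoSample_of_monotone h.mono h.zero.ge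
  have hlow : lower (fun n => ℓ (denseTime n)) = ℓ := by
    ext t; exact lower_eq h.mono h.zero (h.leftCont t)
  have hup : upper (fun n => ℓ (denseTime n)) = Function.rightLim ℓ := by
    ext t; rw [← ha.rightLim_lower, hlow]
  have hruin := h.reserve.ruinTime_eq hr hα (h.claims_mono.add h.mono)
  constructor
  · refine ⟨ha, ?_⟩
    rw [h.sampleReserve_eq hr hα, hlow, hup, ← hruin]
    intro htop
    exact h.lump_le _ (ENNReal.coe_toNNReal htop).le
  · rw [h.pathReturn_eq hδ, sampleReturn, h.sampleReserve_eq hr hα, hup, ← hruin]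

/-- The converse passage: a strategy is rebuilt from samples that satisfy only a measurable
condition. The lump sum restriction is automatic before ruin (`IsReservePath.jump_le`) and is
assumed at the ruin time. -/
theorem IsAdmissibleSample.admissiblePath {a : ℕ → ℝ}
    (h : IsAdmissibleSample p r α x (fun n => y (denseTime n), a)) (hy : Monotone y)
    (hy0 : y 0 = 0) (hyc : ∀ t, ContinuousWithinAt y (Ici t) t) :
    AdmissiblePath p r α x y (lower a) (sampleReserve p r α x (fun n => y (denseTime n), a)) := by
  obtain ⟨ha, hT⟩ := h
  have hg : sampleReserve p r α x (fun n => y (denseTime n), a)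
      = reserveOf p r α x fun t => y t + lower a t := by
    rw [sampleReserve]
    congr 1
    ext t
    rw [upper_eq hy hy0.ge (hyc t)]
  have hmono := hy.add ha.monotone_lower
  have hres : IsReservePath p r α x (fun t => y t + lower a t)
      (sampleReserve p r α x (fun n => y (denseTime n), a)) :=
    hg ▸ isReservePath_reserveOf hr hα x hmono
  refine ⟨hy, hy0, hyc, ha.monotone_lower, lower_zero a, ha.lower_leftCont, hres, fun t ht => ?_⟩
  rcases ht.lt_or_eq with ht | ht
  · exact (hres.jump_le ha.monotone_lower (hyc t) ht).trans (le_max_left _ _)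
  · rw [hres.ruinTime_eq hr hα hmono] at ht
    rw [← ht] at hT
    simpa [ha.rightLim_lower] using hT (by simp)

end Sampling

/-! ### A bound for the return, uniform over strategies -/

section Bound

theorem discounted_exp_ne_top {δ r A B : ℝ} (hr : 0 < r) (hδ : r < δ) (hA : 0 ≤ A) (hB : 0 ≤ B) :
    ∫⁻ u in Ioi (0 : ℝ), ENNReal.ofReal (δ * Real.exp (-(δ * u))) *
      ENNReal.ofReal (A * Real.exp (r * u) + B) ≠ ⊤ := by
  have hδ0 : 0 < δ := hr.trans hδ
  have h1 : ∀ u : ℝ, ENNReal.ofReal (δ * Real.exp (-(δ * u))) *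
      ENNReal.ofReal (A * Real.exp (r * u) + B)
      = ENNReal.ofReal (δ * A * Real.exp ((r - δ) * u) + δ * B * Real.exp (-δ * u)) := by
    intro u
    rw [← ENNReal.ofReal_mul (by positivity)]
    congr 1
    have : Real.exp ((r - δ) * u) = Real.exp (-(δ * u)) * Real.exp (r * u) := by
      rw [← Real.exp_add]; ring_nf
    rw [this, neg_mul]
    ring
  simp_rw [h1]
  have hi : IntegrableOn (fun u => δ * A * Real.exp ((r - δ) * u) + δ * B * Real.exp (-δ * u))
      (Ioi 0) :=
    ((integrableOn_exp_mul_Ioi (by linarith) 0).const_mul _).add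
      ((integrableOn_exp_mul_Ioi (by linarith) 0).const_mul _)
  rw [← ofReal_integral_eq_lintegral_ofReal hi (ae_of_all _ fun u => by positivity)]
  exact ENNReal.ofReal_ne_top

variable {p r α δ x : ℝ} {y ℓ ρ : ℝ≥0 → ℝ} (hp : 0 < p) (hr : 0 < r) (hα : r < α) (hδ : r < δ)
include hp hr hα hδ

theorem AdmissiblePath.pathReturn_le (h : AdmissiblePath p r α x y ℓ ρ) :
    pathReturn p α δ ℓ ρ ≤ ∫⁻ u in Ioi (0 : ℝ), ENNReal.ofReal (δ * Real.exp (-(δ * u))) *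
      ENNReal.ofReal ((max x 0 + p / r) * Real.exp (r * u) + p / α) := by
  rw [h.pathReturn_eq (hr.trans hδ)]
  refine setLIntegral_mono' measurableSet_Ioi fun u (hu : 0 < u) => ?_
  gcongr
  set v := (min (ENNReal.ofReal u) (ruinTime p α ρ)).toNNReal with hv
  have hv' : (v : ℝ≥0∞) = min (ENNReal.ofReal u) (ruinTime p α ρ) :=
    ENNReal.coe_toNNReal (ne_top_of_le_ne_top ENNReal.ofReal_ne_top (min_le_left _ _))
  have hvT : (v : ℝ≥0∞) ≤ ruinTime p α ρ := hv' ▸ min_le_right _ _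
  have hvu : (v : ℝ) ≤ u := by
    rw [← ENNReal.ofReal_le_ofReal_iff hu.le, ENNReal.ofReal_coe_nnreal, hv']
    exact min_le_left _ _
  refine (h.reserve.rightLim_le hp hr hα (fun t => h.claims_zero.ge.trans (h.claims_mono zero_le))
    h.mono h.zero h.leftCont hvT (h.lump_le v hvT)).trans ?_
  have hA : 0 ≤ max x 0 + p / r := by have := le_max_right x 0; positivity
  gcongr

end Bound

/-! ### An additional lump sum at time zero -/

theorem Monotone.zero_le_rightLim {ℓ : ℝ≥0 → ℝ} (hm : Monotone ℓ) (h0 : ℓ 0 = 0) (t : ℝ≥0) :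
    0 ≤ Function.rightLim ℓ t :=
  h0.ge.trans ((hm zero_le).trans (hm.le_rightLim le_rfl))

/-- `δ e^{-δu} du` is a probability measure on `(0, ∞)`: a lump sum at time `0` is worth its full
amount. -/
theorem discounted_add_const {δ c : ℝ} (hδ : 0 < δ) (hc : 0 ≤ c) {h : ℝ≥0 → ℝ} (hh : ∀ t, 0 ≤ h t)
    (τ : ℝ≥0∞) : discounted δ (fun t => h t + c) τ = discounted δ h τ + ENNReal.ofReal c := by
  have h1 : ∫⁻ u in Ioi (0 : ℝ), ENNReal.ofReal (δ * Real.exp (-(δ * u))) = 1 := by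
    rw [setLIntegral_congr Ioi_ae_eq_Ici, lintegral_exp_Ici hδ]; simp
  simp only [discounted, ENNReal.ofReal_add (hh _) hc, mul_add]
  rw [lintegral_add_right _ (by fun_prop), lintegral_mul_const _ (by fun_prop), h1, one_mul]

section Lump

variable {p r α δ x c : ℝ} {y ℓ ρ : ℝ≥0 → ℝ}

/-- Pay `c` at time `0` on top of the dividends `ℓ`. -/
noncomputable def withLump (c : ℝ) (ℓ : ℝ≥0 → ℝ) (t : ℝ≥0) : ℝ := if t = 0 then 0 else ℓ t + c

theorem rightLim_withLump (hm : Monotone ℓ) (t : ℝ≥0) :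
    Function.rightLim (withLump c ℓ) t = Function.rightLim ℓ t + c := by
  refine rightLim_eq_of_tendsto (((hm.tendsto_rightLim t).add_const c).congr' ?_)
  filter_upwards [self_mem_nhdsWithin] with s hs
  rw [withLump, if_neg (pos_of_gt (show t < s from hs)).ne']

/-- Dividends are left-continuous, so a lump sum at time `0` alters the reserve at that single time.
The integral does not see one point, and ruin is unaffected since `x` and `x + c` are both above the
critical level. -/
theorem AdmissiblePath.addLump (h : AdmissiblePath p r α x y ℓ ρ) (hx : -(p / α) < x) (hc : 0 ≤ c) :
    AdmissiblePath p r α (x + c) y (withLump c ℓ) (Function.update ρ 0 (x + c)) ∧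
    ruinTime p α (Function.update ρ 0 (x + c)) = ruinTime p α ρ := by
  have hρ0 : ρ 0 = x := by
    rw [(h.reserve 0).2]; simp [h.claims_zero, h.zero]
  have hne : ∀ t : ℝ≥0, t ≠ 0 → Function.update ρ 0 (x + c) t = ρ t := fun t ht =>
    Function.update_of_ne ht _ _
  have hn : ∀ t, 0 ≤ ℓ t := fun t => h.zero.ge.trans (h.mono zero_le)
  have hruin : ruinTime p α (Function.update ρ 0 (x + c)) = ruinTime p α ρ := by
    refine iInf_congr fun t => iInf_congr_Prop ?_ fun _ => rfl
    rcases eq_or_ne t 0 with rfl | ht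
    · rw [Function.update_self, hρ0]
      constructor <;> intro <;> linarith
    · rw [hne t ht]
  refine ⟨⟨h.claims_mono, h.claims_zero, h.claims_rightCont, ?_, by simp [withLump],
    ?_, ?_, ?_⟩, hruin⟩
  · intro s t hst
    simp only [withLump]
    split_ifs with h1 h2 h2
    · exact le_rfl
    · exact add_nonneg (hn t) hc
    · exact absurd (le_antisymm (hst.trans h2.le) zero_le) h1
    · exact add_le_add_left (h.mono hst) c
  · intro t
    rcases eq_or_ne t 0 with rfl | ht
    · have : Iic (0 : ℝ≥0) = {0} := by ext; simp
      rw [this]; exact continuousWithinAt_singleton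
    · refine ((h.leftCont t).add (continuousWithinAt_const (b := c))).congr_of_eventuallyEq ?_
        (by simp [withLump, ht])
      have : Ioi 0 ∈ 𝓝[≤] t := mem_nhdsWithin_of_mem_nhds (Ioi_mem_nhds (pos_iff_ne_zero.2 ht))
      filter_upwards [this] with s hs
      simp [withLump, (ne_of_gt hs : s ≠ 0)]
  · intro t
    have hcongr : EqOn (fun s : ℝ => drift p r α (Function.update ρ 0 (x + c) s.toNNReal))
        (fun s => drift p r α (ρ s.toNNReal)) (Ioc 0 (t : ℝ)) := by
      intro s hs
      have : s.toNNReal ≠ 0 := (Real.toNNReal_pos.2 hs.1).ne'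
      simp only [hne _ this]
    have h1 := h.reserve t
    constructor
    · refine h1.1.congr ?_
      rw [uIoc_of_le t.coe_nonneg]
      exact fun s hs => (hcongr hs).symm
    · rw [intervalIntegral.integral_of_le t.coe_nonneg, setIntegral_congr_fun measurableSet_Ioc hcongr,
        ← intervalIntegral.integral_of_le t.coe_nonneg]
      rcases eq_or_ne t 0 with rfl | ht
      · simp [withLump, h.claims_zero]
      · rw [hne t ht, h1.2]; simp only [withLump, if_neg ht]; ring
  · intro t ht
    rw [hruin] at ht
    have h1 := h.lump_le t ht
    rw [rightLim_withLump h.mono]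
    rcases eq_or_ne t 0 with rfl | ht0
    · rw [hρ0, h.zero, max_eq_left (by linarith)] at h1
      rw [Function.update_self, max_eq_left (by linarith)]
      simp only [withLump, if_pos]
      linarith
    · rw [hne t ht0]
      simpa [withLump, ht0] using h1

theorem AdmissiblePath.pathReturn_withLump (h : AdmissiblePath p r α x y ℓ ρ) (hδ : 0 < δ)
    (hx : -(p / α) < x) (hc : 0 ≤ c) :
    pathReturn p α δ (withLump c ℓ) (Function.update ρ 0 (x + c))
      = pathReturn p α δ ℓ ρ + ENNReal.ofReal c := by
  obtain ⟨h', hruin⟩ := h.addLump hx hc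
  rw [h'.pathReturn_eq hδ, h.pathReturn_eq hδ, hruin,
    ← discounted_add_const hδ hc (Monotone.zero_le_rightLim h.mono h.zero)]
  congr 1
  ext t
  exact rightLim_withLump h.mono t

end Lump

/-! ### Waiting while the reserve climbs -/

section Climb

/-- `ψ` is the reserve path without claims and dividends which climbs from `x` to `y` in time `θ`. -/
structure IsClimb (p r α x y : ℝ) (θ : ℝ≥0) (ψ : ℝ → ℝ) : Prop where
  deriv : ∀ t ∈ Icc (0 : ℝ) θ, HasDerivAt ψ (drift p r α (ψ t)) t
  start : ψ 0 = x
  finish : ψ θ = y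
  above : ∀ t ∈ Icc (0 : ℝ) θ, -(p / α) < ψ t

variable {p r α δ x z : ℝ} {θ : ℝ≥0} {ψ : ℝ → ℝ}

theorem IsClimb.integral (h : IsClimb p r α x z θ ψ) (hr : 0 < r) (hα : r < α) {t : ℝ}
    (ht : t ∈ Icc (0 : ℝ) θ) : IntervalIntegrable (fun s => drift p r α (ψ s)) volume 0 t ∧
      ∫ s in (0 : ℝ)..t, drift p r α (ψ s) = ψ t - x := by
  have hsub : uIcc 0 t ⊆ Icc (0 : ℝ) θ := by
    rw [uIcc_of_le ht.1]; exact Icc_subset_Icc_right ht.2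
  have hi : IntervalIntegrable (fun s => drift p r α (ψ s)) volume 0 t := by
    refine ContinuousOn.intervalIntegrable fun s hs => ?_
    exact ((lipschitzWith_drift (p := p) hr hα).continuous.continuousAt.comp
      (h.deriv s (hsub hs)).continuousAt).continuousWithinAt
  refine ⟨hi, ?_⟩
  rw [intervalIntegral.integral_eq_sub_of_hasDerivAt (fun s hs => h.deriv s (hsub hs)) hi, h.start]

theorem isClimb_credit (hp : 0 < p) (hr : 0 < r) (hα : r < α) (hx : 0 ≤ x) (hxz : x < z) :
    IsClimb p r α x z (t₀ p r α x z).toNNReal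
      fun t => (x + p / r) * Real.exp (r * t) - p / r := by
  have hrz : 0 < r * z + p := by nlinarith
  have hrx : 0 < r * x + p := by nlinarith
  have ht : t₀ p r α x z = 1 / r * Real.log ((r * z + p) / (r * x + p)) := by rw [t₀, if_pos hx]
  have ht0 : 0 ≤ t₀ p r α x z := by
    rw [ht]
    have : 0 ≤ Real.log ((r * z + p) / (r * x + p)) :=
      Real.log_nonneg (by rw [le_div_iff₀ hrx]; nlinarith)
    positivity
  have hge : ∀ t : ℝ, 0 ≤ t → 0 ≤ (x + p / r) * Real.exp (r * t) - p / r := by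
    intro t ht
    have h1 : 1 ≤ Real.exp (r * t) := Real.one_le_exp (by positivity)
    have h2 : 0 < p / r := by positivity
    nlinarith
  refine ⟨fun t ht => ?_, by simp, ?_, fun t ht => ?_⟩
  · have h1 := ((((hasDerivAt_id t).const_mul r).exp).const_mul (x + p / r)).sub_const (p / r)
    refine h1.congr_deriv ?_
    rw [drift, if_pos (hge t ht.1)]
    simp only [id]
    field_simp
    ring
  · rw [Real.coe_toNNReal _ ht0, ht, ← mul_assoc, mul_one_div_cancel hr.ne', one_mul,
      Real.exp_log (by positivity)]
    field_simp
    ring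
  · have : 0 < p / α := div_pos hp (hr.trans hα)
    linarith [hge t ht.1]

/-- With `z ≤ 0` the whole climb stays in the debit regime, where the equation is linear. A climb
through `0` is composed later from a debit and a credit climb. -/
theorem isClimb_debit (hr : 0 < r) (hα : r < α) (hx : -(p / α) < x) (hxz : x < z)
    (hz : z ≤ 0) :
    IsClimb p r α x z (t₀ p r α x z).toNNReal
      fun t => (x + p / α) * Real.exp (α * t) - p / α := by
  have hα0 : 0 < α := hr.trans hα
  have hx' : 0 < x + p / α := by linarith
  have hrx : 0 < α * x + p := by
    have : α * (x + p / α) = α * x + p := by field_simp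
    rw [← this]; positivity
  have hrz : 0 < α * z + p := by nlinarith
  have ht : t₀ p r α x z = 1 / α * Real.log ((α * z + p) / (α * x + p)) := by
    rw [t₀, if_neg (by linarith), if_neg (by linarith)]
  have ht0 : 0 ≤ t₀ p r α x z := by
    rw [ht]
    have : 0 ≤ Real.log ((α * z + p) / (α * x + p)) :=
      Real.log_nonneg (by rw [le_div_iff₀ hrx]; nlinarith)
    positivity
  have hfin : (x + p / α) * Real.exp (α * t₀ p r α x z) - p / α = z := by
    rw [ht, ← mul_assoc, mul_one_div_cancel hα0.ne', one_mul, Real.exp_log (by positivity),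
      show x + p / α = (α * x + p) / α by field_simp]
    have := hrx.ne'
    field_simp
    ring
  refine ⟨fun t ht => ?_, by simp, ?_, fun t ht => ?_⟩
  · have h1 := ((((hasDerivAt_id t).const_mul α).exp).const_mul (x + p / α)).sub_const (p / α)
    refine h1.congr_deriv ?_
    rw [Real.coe_toNNReal _ ht0] at ht
    have hle : (x + p / α) * Real.exp (α * t) - p / α ≤ 0 := by
      have h2 : Real.exp (α * t) ≤ Real.exp (α * t₀ p r α x z) := by
        have := ht.2
        gcongr
      nlinarith
    have hd : drift p r α ((x + p / α) * Real.exp (α * t) - p / α)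
        = p + α * ((x + p / α) * Real.exp (α * t) - p / α) := by
      rw [drift_eq, max_eq_right hle, min_eq_left hle]; ring
    rw [hd]
    simp only [id]
    field_simp
    ring
  · rw [Real.coe_toNNReal _ ht0, hfin]
  · have := Real.exp_pos (α * t)
    have := mul_pos hx' this
    linarith

/-- Follow the climb `ψ` up to time `θ`, then the path `ρ`. -/
noncomputable def climbThen (θ : ℝ≥0) (ψ : ℝ → ℝ) (ρ : ℝ≥0 → ℝ) (t : ℝ≥0) : ℝ :=
  if t < θ then ψ t else ρ (t - θ)

theorem climbThen_add (ρ : ℝ≥0 → ℝ) (s : ℝ≥0) : climbThen θ ψ ρ (θ + s) = ρ s := by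
  rw [climbThen, if_neg (by simp), add_tsub_cancel_left]

theorem IsClimb.ruinTime_climbThen (h : IsClimb p r α x z θ ψ) (ρ : ℝ≥0 → ℝ) :
    ruinTime p α (climbThen θ ψ ρ) = θ + ruinTime p α ρ := by
  refine le_antisymm ?_ (le_iInf₂ fun t ht => ?_)
  · rw [ruinTime, ruinTime, ENNReal.add_iInf]
    refine le_iInf fun s => ?_
    by_cases hs : ρ s ≤ -(p / α)
    · simp only [hs, iInf_pos]
      refine iInf₂_le_of_le (θ + s) ?_ (by simp)
      rwa [climbThen_add]
    · simp [hs]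
  · by_cases htθ : t < θ
    · rw [climbThen, if_pos htθ] at ht
      exact absurd ht (not_le.2 (h.above t ⟨t.coe_nonneg, NNReal.coe_le_coe.2 htθ.le⟩))
    · obtain ⟨s, rfl⟩ := exists_add_of_le (not_lt.1 htθ)
      rw [climbThen_add] at ht
      rw [ENNReal.coe_add]
      gcongr
      exact iInf₂_le (f := fun (s : ℝ≥0) (_ : ρ s ≤ -(p / α)) => (s : ℝ≥0∞)) s ht

variable {y ℓ ρ : ℝ≥0 → ℝ}

theorem rightLim_shift_add (hm : Monotone ℓ) (s : ℝ≥0) :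
    Function.rightLim (fun t => ℓ (t - θ)) (θ + s) = Function.rightLim ℓ s := by
  refine rightLim_eq_of_tendsto ((hm.tendsto_rightLim s).comp
    (tendsto_nhdsWithin_iff.2 ⟨?_, ?_⟩))
  · have : Continuous fun t : ℝ≥0 => t - θ := by fun_prop
    have h2 := this.tendsto (θ + s)
    rw [add_tsub_cancel_left] at h2
    exact h2.mono_left nhdsWithin_le_nhds
  · filter_upwards [self_mem_nhdsWithin] with t ht
    exact lt_tsub_iff_left.2 (show θ + s < t from ht)

/-- Truncated subtraction makes the shifted claims and dividends vanish up to `θ`. After `θ` the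
integral splits into the climb, which contributes `z - x`, and a translate of the equation for `ρ`.
-/
theorem AdmissiblePath.afterClimb (h : AdmissiblePath p r α z y ℓ ρ) (hψ : IsClimb p r α x z θ ψ)
    (hr : 0 < r) (hα : r < α) {w : ℝ≥0 → ℝ} (hw : ∀ t, w t = y (t - θ)) :
    AdmissiblePath p r α x w (fun t => ℓ (t - θ)) (climbThen θ ψ ρ) := by
  have hsub : Monotone fun t : ℝ≥0 => t - θ := fun s t hst => tsub_le_tsub_right hst θ
  have hsubc : Continuous fun t : ℝ≥0 => t - θ := by fun_prop
  obtain rfl : w = fun t => y (t - θ) := funext hw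
  refine ⟨h.claims_mono.comp hsub, by simp [h.claims_zero], fun t => ?_, h.mono.comp hsub,
    by simp [h.zero], fun t => ?_, fun t => ?_, fun t ht => ?_⟩
  · exact (h.claims_rightCont (t - θ)).comp (f := fun t : ℝ≥0 => t - θ) hsubc.continuousWithinAt
      fun s hs => hsub hs
  · exact (h.leftCont (t - θ)).comp (f := fun t : ℝ≥0 => t - θ) hsubc.continuousWithinAt
      fun s hs => hsub hs
  · have hearly : ∀ t : ℝ, t ∈ Icc (0 : ℝ) θ →
        IntervalIntegrable (fun s : ℝ => drift p r α (climbThen θ ψ ρ s.toNNReal)) volume 0 t ∧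
        ∫ s in (0 : ℝ)..t, drift p r α (climbThen θ ψ ρ s.toNNReal) = ψ t - x := by
      intro t ht
      obtain ⟨h1, h2⟩ := hψ.integral hr hα ht
      have hcongr : ∀ᵐ s : ℝ, s ∈ uIoc 0 t → drift p r α (ψ s)
          = drift p r α (climbThen θ ψ ρ s.toNNReal) := by
        have hne : ∀ᵐ s : ℝ, s ≠ θ := by simp [ae_iff]
        filter_upwards [hne] with s hs hst
        rw [uIoc_of_le ht.1] at hst
        have hlt : s.toNNReal < θ := by
          rw [Real.toNNReal_lt_iff_lt_coe hst.1.le]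
          exact lt_of_le_of_ne (hst.2.trans ht.2) hs
        rw [climbThen, if_pos hlt, Real.coe_toNNReal s hst.1.le]
      refine ⟨h1.congr_ae ((ae_restrict_iff' measurableSet_uIoc).2 hcongr), ?_⟩
      rw [← h2]
      exact (intervalIntegral.integral_congr_ae hcongr).symm
    have hθ := hearly θ ⟨θ.coe_nonneg, le_rfl⟩
    by_cases htθ : t < θ
    · obtain ⟨h1, h2⟩ := hearly t ⟨t.coe_nonneg, NNReal.coe_le_coe.2 htθ.le⟩
      refine ⟨h1, ?_⟩
      rw [h2, climbThen, if_pos htθ]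
      simp only [tsub_eq_zero_of_le htθ.le, h.claims_zero, h.zero]
      ring
    · obtain ⟨s, rfl⟩ := exists_add_of_le (not_lt.1 htθ)
      obtain ⟨h1, h2⟩ := h.reserve s
      have hlate : EqOn (fun u : ℝ => drift p r α (ρ (u - θ).toNNReal))
          (fun u : ℝ => drift p r α (climbThen θ ψ ρ u.toNNReal))
          (uIcc (θ : ℝ) ((θ + s : ℝ≥0) : ℝ)) := by
        intro u hu
        rw [uIcc_of_le (by simp)] at hu
        have hθu : θ ≤ u.toNNReal := NNReal.le_toNNReal_of_coe_le hu.1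
        simp only [climbThen, if_neg (not_lt.2 hθu)]
        rw [NNReal.sub_def, Real.coe_toNNReal u (θ.coe_nonneg.trans hu.1)]
      have hi : IntervalIntegrable (fun u : ℝ => drift p r α (ρ (u - θ).toNNReal)) volume
          (θ : ℝ) ((θ + s : ℝ≥0) : ℝ) := by
        have := h1.comp_sub_right (θ : ℝ)
        simpa [add_comm] using this
      have hi' := hi.congr (g := fun u : ℝ => drift p r α (climbThen θ ψ ρ u.toNNReal))
        (fun u hu => hlate (uIoc_subset_uIcc hu))
      refine ⟨hθ.1.trans hi', ?_⟩
      rw [← intervalIntegral.integral_add_adjacent_intervals hθ.1 hi', hθ.2,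
        ← intervalIntegral.integral_congr hlate,
        intervalIntegral.integral_comp_sub_right (fun u => drift p r α (ρ u.toNNReal)) (θ : ℝ),
        climbThen_add, h2, hψ.finish]
      simp only [add_tsub_cancel_left, NNReal.coe_add, sub_self]
      ring
  · rw [hψ.ruinTime_climbThen] at ht
    by_cases htθ : t < θ
    · have : Function.rightLim (fun t => ℓ (t - θ)) t = 0 := by
        refine rightLim_eq_of_tendsto (tendsto_const_nhds.congr' ?_)
        have : Iio θ ∈ 𝓝[>] t := mem_nhdsWithin_of_mem_nhds (Iio_mem_nhds htθ)
        filter_upwards [this] with s hs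
        rw [tsub_eq_zero_of_le (le_of_lt hs), h.zero]
      rw [this, tsub_eq_zero_of_le htθ.le, h.zero]
      simp
    · obtain ⟨s, rfl⟩ := exists_add_of_le (not_lt.1 htθ)
      rw [rightLim_shift_add h.mono, climbThen_add, add_tsub_cancel_left]
      rw [ENNReal.coe_add] at ht
      exact h.lump_le s ((ENNReal.add_le_add_iff_left ENNReal.coe_ne_top).1 ht)

/-- Translating `u` by `θ` in `discounted` produces the factor `e^{-δθ}`; the integral over `(0, θ]`
is discarded. -/
theorem AdmissiblePath.le_pathReturn_climbThen (h : AdmissiblePath p r α z y ℓ ρ)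
    (hψ : IsClimb p r α x z θ ψ) (hr : 0 < r) (hα : r < α) (hδ : 0 < δ) :
    ENNReal.ofReal (Real.exp (-(δ * θ))) * pathReturn p α δ ℓ ρ
      ≤ pathReturn p α δ (fun t => ℓ (t - θ)) (climbThen θ ψ ρ) := by
  have h' := h.afterClimb hψ hr hα (w := fun t => y (t - θ)) fun _ => rfl
  rw [h.pathReturn_eq hδ, h'.pathReturn_eq hδ, hψ.ruinTime_climbThen, discounted, discounted,
    ← lintegral_const_mul' _ _ ENNReal.ofReal_ne_top]
  set T := ruinTime p α ρ
  set F : ℝ → ℝ≥0∞ := fun u => ENNReal.ofReal (δ * Real.exp (-(δ * u))) *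
    ENNReal.ofReal (Function.rightLim (fun t => ℓ (t - θ)) (min (ENNReal.ofReal u) (θ + T)).toNNReal)
  calc _ = ∫⁻ u in Ioi (0 : ℝ), F (u + θ) := by
        refine setLIntegral_congr_fun measurableSet_Ioi fun u (hu : 0 < u) => ?_
        have hmin : (min (ENNReal.ofReal (u + θ)) (θ + T)).toNNReal
            = θ + (min (ENNReal.ofReal u) T).toNNReal := by
          rw [ENNReal.ofReal_add hu.le θ.coe_nonneg, ENNReal.ofReal_coe_nnreal, add_comm _ (θ : ℝ≥0∞),
            min_add_add_left, ENNReal.toNNReal_add ENNReal.coe_ne_top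
              (ne_top_of_le_ne_top ENNReal.ofReal_ne_top (min_le_left _ _)), ENNReal.toNNReal_coe]
        simp only [F, hmin, rightLim_shift_add h.mono]
        rw [← mul_assoc, ← ENNReal.ofReal_mul (Real.exp_pos _).le]
        congr 2
        rw [mul_add, neg_add, Real.exp_add]
        ring
    _ = ∫⁻ u in Ioi (θ : ℝ), F u := by
        rw [← lintegral_indicator measurableSet_Ioi, ← lintegral_indicator measurableSet_Ioi,
          ← lintegral_add_right_eq_self ((Ioi (θ : ℝ)).indicator F) (θ : ℝ)]
        refine lintegral_congr fun u => ?_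
        simp [indicator]
    _ ≤ _ := lintegral_mono_set (Ioi_subset_Ioi θ.coe_nonneg)

end Climb

/-! ### Restarting the Poisson process and the compound claims -/

theorem measurable_of_mem_block {Ω ι : Type*} {Z : ι → Ω → ℝ} {S : Set ι} {i : ι} (hi : i ∈ S) :
    Measurable[⨆ i ∈ S, MeasurableSpace.comap (Z i) inferInstance] (Z i) :=
  (comap_measurable (Z i)).mono
    (le_iSup₂ (f := fun i (_ : i ∈ S) => MeasurableSpace.comap (Z i) inferInstance) i hi) le_rfl

theorem sum_increments {N : ℝ≥0 → ℝ} {s : ℕ → ℝ≥0} (h0 : s 0 = 0) (θ : ℝ≥0) (n : ℕ) :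
    ∑ j ∈ Finset.range n, (N (θ + s (j + 1)) - N (θ + s j)) = N (θ + s n) - N θ := by
  rw [Finset.sum_range_sub (fun j => N (θ + s j)), h0, add_zero]

variable {Ω : Type*} [mΩ : MeasurableSpace Ω] {μ : Measure Ω} {lam : ℝ} {F : Measure ℝ}

/-- Functions of disjoint blocks of an independent family are independent. -/
theorem iIndepFun.indepFun_of_disjoint {ι β γ : Type*} {Z : ι → Ω → ℝ} [MeasurableSpace β]
    [MeasurableSpace γ] (hZ : iIndepFun Z μ) (hm : ∀ i, Measurable (Z i)) {S T : Set ι}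
    (hST : Disjoint S T) {f : Ω → β} {g : Ω → γ}
    (hf : Measurable[⨆ i ∈ S, MeasurableSpace.comap (Z i) inferInstance] f)
    (hg : Measurable[⨆ i ∈ T, MeasurableSpace.comap (Z i) inferInstance] g) :
    IndepFun f g μ := by
  have h := indep_iSup_of_disjoint (fun i => (hm i).comap_le) hZ hST
  exact indep_of_indep_of_le_left (indep_of_indep_of_le_right h hg.comap_le) hf.comap_le

/-- A finite set of times is enumerated by a monotone sequence which starts at `0`. -/
theorem exists_monotone_enum (I : Finset ℝ≥0) :
    ∃ (s : ℕ → ℝ≥0) (e : ℝ≥0 → ℕ), Monotone s ∧ s 0 = 0 ∧ ∀ i ∈ I, s (e i) = i := by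
  classical
  refine ⟨fun n => (I.filter fun i => (I.filter (· < i)).card + 1 ≤ n).sup id,
    fun i => (I.filter (· < i)).card + 1, ?_, by simp, ?_⟩
  · intro m n hmn
    refine Finset.sup_mono fun i hi => ?_
    simp only [Finset.mem_filter] at hi ⊢
    exact ⟨hi.1, hi.2.trans hmn⟩
  · intro i hi
    refine le_antisymm (Finset.sup_le fun j hj => ?_)
      (Finset.le_sup (f := id) (Finset.mem_filter.2 ⟨hi, le_rfl⟩))
    simp only [Finset.mem_filter] at hj
    by_contra! hij
    have hij : i < j := hij
    have : (I.filter (· < i)).card < (I.filter (· < j)).card := by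
      refine Finset.card_lt_card ((Finset.ssubset_iff_of_subset fun k hk => ?_).2 ⟨i, ?_, ?_⟩)
      · simp only [Finset.mem_filter] at hk ⊢
        exact ⟨hk.1, hk.2.trans hij⟩
      · simp [hi, hij]
      · simp
    omega

namespace IsPoissonProcess

variable {N : ℝ≥0 → Ω → ℕ} (hN : IsPoissonProcess μ lam N)
include hN

theorem measurable_cast (t : ℝ≥0) : Measurable fun ω => (N t ω : ℝ) :=
  measurable_from_nat.comp (hN.measurable t)

theorem measurable_increment (s t : ℝ≥0) : Measurable fun ω => (N t ω : ℝ) - N s ω :=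
  (hN.measurable_cast t).sub (hN.measurable_cast s)

theorem map_increments {s : ℕ → ℝ≥0} (hs : Monotone s) (θ : ℝ≥0) :
    μ.map (fun ω j => (N (θ + s (j + 1)) ω : ℝ) - N (θ + s j) ω)
      = Measure.infinitePi fun j => (poissonMeasure (Real.toNNReal (lam * (s (j + 1) - s j)))).map
          (fun n : ℕ => (n : ℝ)) := by
  have hmono : Monotone fun j => θ + s j := hs.const_add θ
  have h := hN.indep.nat hmono
  rw [h.map_fun_eq_infinitePi_map
    fun j => hN.measurable_increment _ _]
  congr 1
  ext1 j
  rw [hN.law _ _ (hmono (Nat.le_succ j))]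
  congr 4
  push_cast
  ring

/-- The law of a process is fixed by its finite-dimensional marginals. These are sums of increments
over an enumeration of the times, and the law of the increments depends only on the differences of
times. -/
theorem map_shift [IsProbabilityMeasure μ] (θ : ℝ≥0) :
    μ.map (fun ω (t : ℝ≥0) => (N (θ + t) ω : ℝ) - N θ ω) = μ.map (fun ω (t : ℝ≥0) => (N t ω : ℝ)) := by
  have hm : ∀ θ : ℝ≥0, Measurable fun ω (t : ℝ≥0) => (N (θ + t) ω : ℝ) - N θ ω := fun θ =>
    measurable_pi_lambda _ fun t => hN.measurable_increment _ _
  have h0 : μ.map (fun ω (t : ℝ≥0) => (N (0 + t) ω : ℝ) - N 0 ω)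
      = μ.map (fun ω (t : ℝ≥0) => (N t ω : ℝ)) := by
    refine Measure.map_congr ?_
    filter_upwards [hN.zero] with ω hω
    simp [hω]
  rw [← h0]
  refine (map_eq_iff_forall_finset_map_restrict_eq
    (X := fun (t : ℝ≥0) ω => (N (θ + t) ω : ℝ) - N θ ω)
    (Y := fun (t : ℝ≥0) ω => (N (0 + t) ω : ℝ) - N 0 ω) (hm θ).aemeasurable
    (hm 0).aemeasurable).2 fun I => ?_
  obtain ⟨s, e, hs, hs0, he⟩ := exists_monotone_enum I
  have key : ∀ θ : ℝ≥0, μ.map (fun ω => I.restrict fun t : ℝ≥0 => (N (θ + t) ω : ℝ) - N θ ω)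
      = (Measure.infinitePi fun j =>
          (poissonMeasure (Real.toNNReal (lam * (s (j + 1) - s j)))).map (fun n : ℕ => (n : ℝ))).map
        (fun z (i : I) => ∑ j ∈ Finset.range (e i), z j) := by
    intro θ
    rw [← hN.map_increments hs θ, Measure.map_map (measurable_pi_lambda _ fun i =>
        Finset.measurable_fun_sum _ fun j _ => measurable_pi_apply j)
      (measurable_pi_lambda _ fun j => hN.measurable_increment _ _)]
    congr 1
    ext ω i
    simp only [Function.comp_apply, Finset.restrict]
    rw [sum_increments (N := fun t => (N t ω : ℝ)) hs0, he i i.2]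
  rw [key θ, key 0]

theorem indepFun_shift [IsProbabilityMeasure μ] (θ : ℝ≥0) :
    IndepFun (fun ω => (N θ ω : ℝ)) (fun ω (t : ℝ≥0) => (N (θ + t) ω : ℝ) - N θ ω) μ := by
  refine IndepFun.indepFun_process (Y := fun (t : ℝ≥0) ω => (N (θ + t) ω : ℝ) - N θ ω)
    (hN.measurable_cast _) (fun t => hN.measurable_increment _ _) fun I => ?_
  obtain ⟨s, e, hs, hs0, he⟩ := exists_monotone_enum I
  -- The grid is `0, θ + s 0 = θ, θ + s 1, …`: its first increment is `N θ - N 0`, and the remaining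
  -- ones build the shifted process.
  set τ : ℕ → ℝ≥0 := fun j => if j = 0 then 0 else θ + s (j - 1) with hτ
  have hmono : Monotone τ := by
    refine monotone_nat_of_le_succ fun j => ?_
    rcases j with _ | j
    · simp [hτ]
    · simp only [hτ, Nat.add_eq_zero_iff, one_ne_zero, and_false, if_false, add_tsub_cancel_right]
      exact add_le_add_right (hs (Nat.le_succ j)) θ
  have hi := hN.indep.nat hmono
  have h := iIndepFun.indepFun_of_disjoint (β := ℝ) (γ := I → ℝ) hi
    (fun j => hN.measurable_increment _ _)
    (S := {0}) (T := {0}ᶜ) disjoint_compl_right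
    (f := fun ω => (N θ ω : ℝ) - N 0 ω)
    (g := fun ω i => ∑ j ∈ Finset.range (e i), ((N (τ (j + 1 + 1)) ω : ℝ) - N (τ (j + 1)) ω)) ?_ ?_
  · refine h.congr ?_ ?_
    · filter_upwards [hN.zero] with ω hω
      simp [hω]
    · refine ae_of_all _ fun ω => funext fun i => ?_
      have := sum_increments (N := fun t => (N t ω : ℝ)) hs0 θ (e i)
      rw [he i i.2] at this
      simpa [hτ] using this
  · have := measurable_of_mem_block (Z := fun j ω => (N (τ (j + 1)) ω : ℝ) - N (τ j) ω)
      (S := {0}) (mem_singleton 0)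
    simpa [hτ, hs0] using this
  · refine @measurable_pi_lambda _ _ _ (_) _ _ fun i => Finset.measurable_fun_sum _ fun j _ => ?_
    exact measurable_of_mem_block (Z := fun j ω => (N (τ (j + 1)) ω : ℝ) - N (τ j) ω)
      (S := {0}ᶜ) (i := j + 1) (by simp)

theorem measure_eq_zero (hlam : 0 < lam) (θ : ℝ≥0) :
    μ {ω | N θ ω = 0} = ENNReal.ofReal (Real.exp (-(lam * θ))) := by
  have h := hN.law 0 θ zero_le
  have h1 : μ {ω | N θ ω = 0} = μ.map (fun ω => (N θ ω : ℝ) - N 0 ω) {0} := by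
    rw [Measure.map_apply (hN.measurable_increment _ _)
      (measurableSet_singleton _)]
    refine measure_congr ?_
    filter_upwards [hN.zero] with ω hω
    refine propext ?_
    change N θ ω = 0 ↔ (N θ ω : ℝ) - N 0 ω = 0
    simp [hω]
  rw [h1, h, Measure.map_apply measurable_from_nat (measurableSet_singleton _)]
  have : (fun n : ℕ => (n : ℝ)) ⁻¹' {0} = {0} := by ext; simp
  rw [this, poissonMeasure_singleton]
  simp [max_eq_left (mul_nonneg hlam.le θ.coe_nonneg)]

end IsPoissonProcess

/-- The compound path with jump counts `z.1` and jump sizes `z.2`. -/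
noncomputable def compound (z : (ℝ≥0 → ℝ) × (ℕ → ℝ)) (t : ℝ≥0) : ℝ :=
  ∑ i ∈ Finset.range ⌊z.1 t⌋₊, z.2 i

theorem measurable_compound : Measurable compound := by
  refine measurable_pi_lambda _ fun t => ?_
  have h : Measurable fun q : ℕ × (ℕ → ℝ) => ∑ i ∈ Finset.range q.1, q.2 i :=
    measurable_from_prod_countable_right fun n =>
      Finset.measurable_fun_sum (Finset.range n) fun i _ => measurable_pi_apply i
  have h2 : Measurable fun z : (ℝ≥0 → ℝ) × (ℕ → ℝ) => (⌊z.1 t⌋₊, z.2) := by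
    have : Measurable fun z : (ℝ≥0 → ℝ) × (ℕ → ℝ) => z.1 t := by fun_prop
    exact (Nat.measurable_floor.comp this).prodMk measurable_snd
  exact h.comp h2

namespace Claims

variable (C : Claims μ lam F)

theorem Y_eq_compound (ω : Ω) :
    (fun t => C.Y t ω) = compound (fun t => (C.N t ω : ℝ), fun i => C.U i ω) := by
  ext t; simp [Y, compound]

/-- The number of claims as a random real path. -/
def numberPath (ω : Ω) (t : ℝ≥0) : ℝ := C.N t ω

/-- The aggregate claims as a random path. -/
def path (ω : Ω) (t : ℝ≥0) : ℝ := C.Y t ω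

/-- The aggregate claims after time `θ`. -/
def shiftPath (θ : ℝ≥0) (ω : Ω) (t : ℝ≥0) : ℝ := C.Y (θ + t) ω - C.Y θ ω

theorem measurable_path : Measurable C.path := measurable_pi_lambda _ fun t => C.measurable_Y t

theorem measurable_shiftPath (θ : ℝ≥0) : Measurable (C.shiftPath θ) :=
  measurable_pi_lambda _ fun _ => (C.measurable_Y _).sub (C.measurable_Y _)

theorem measurable_claimSizes : Measurable fun ω i => C.U i ω :=
  measurable_pi_lambda _ C.measurable_U

theorem measurable_numberPath : Measurable C.numberPath :=
  measurable_pi_lambda _ fun t => C.poisson.measurable_cast t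

theorem map_shift_claimSizes (k : ℕ) :
    μ.map (fun ω i => C.U (k + i) ω) = μ.map fun ω i => C.U i ω := by
  rw [(C.iIndep_U.precomp (add_right_injective k)).map_fun_eq_infinitePi_map
      (X := fun i => C.U (k + i)) fun i => C.measurable_U _,
    C.iIndep_U.map_fun_eq_infinitePi_map C.measurable_U]
  simp only [C.law_U]

theorem indepFun_claimSizes (k : ℕ) :
    IndepFun (fun ω => ∑ i ∈ Finset.range k, C.U i ω) (fun ω i => C.U (k + i) ω) μ := by
  refine iIndepFun.indepFun_of_disjoint C.iIndep_U C.measurable_U (S := Iio k) (T := Ici k) ?_ ?_ ?_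
  · exact Set.disjoint_left.2 fun i hi hi' => absurd (show k ≤ i from hi') (not_le.2 hi)
  · exact Finset.measurable_fun_sum _ fun i hi => measurable_of_mem_block (Finset.mem_range.1 hi)
  · refine @measurable_pi_lambda _ _ _ (_) _ _ fun i => ?_
    exact measurable_of_mem_block (i := k + i) (Nat.le_add_right k i)

theorem indepFun_number_claimSizes : IndepFun C.numberPath (fun ω i => C.U i ω) μ := by
  refine (C.indep_U_N.symm).comp (φ := fun n (t : ℝ≥0) => ((n t : ℕ) : ℝ)) (ψ := id) ?_ measurable_id
  exact measurable_pi_lambda _ fun t => measurable_from_nat.comp (measurable_pi_apply t)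

variable [IsProbabilityMeasure μ]

theorem map_path :
    μ.map C.path = ((μ.map C.numberPath).prod (μ.map fun ω i => C.U i ω)).map compound := by
  rw [← (indepFun_iff_map_prod_eq_prod_map_map C.measurable_numberPath.aemeasurable
    C.measurable_claimSizes.aemeasurable).1 C.indepFun_number_claimSizes,
    Measure.map_map measurable_compound (C.measurable_numberPath.prodMk C.measurable_claimSizes)]
  congr 1
  ext1 ω
  exact C.Y_eq_compound ω

/-- Given that the first `k` claims arrive up to time `θ` and vanish, the numbers and the sizes of
the later claims have their unconditional law. -/
theorem measure_inter_shift (θ : ℝ≥0) (k : ℕ) {D : Set ((ℝ≥0 → ℝ) × (ℕ → ℝ))}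
    (hD : MeasurableSet D) :
    μ ({ω | C.N θ ω = k ∧ ∑ i ∈ Finset.range k, C.U i ω = 0} ∩
      {ω | (fun t : ℝ≥0 => (C.N (θ + t) ω : ℝ) - C.N θ ω, fun i => C.U (k + i) ω) ∈ D})
    = μ {ω | C.N θ ω = k ∧ ∑ i ∈ Finset.range k, C.U i ω = 0} *
      ((μ.map C.numberPath).prod (μ.map fun ω i => C.U i ω)) D := by
  set E := {ω | C.N θ ω = k ∧ ∑ i ∈ Finset.range k, C.U i ω = 0} with hE
  set f : Ω → (ℝ≥0 → ℝ) × (ℕ → ℝ) := fun ω =>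
    (fun t : ℝ≥0 => (C.N (θ + t) ω : ℝ) - C.N θ ω, fun i => C.U (k + i) ω) with hf
  have hsum : Measurable fun ω => ∑ i ∈ Finset.range k, C.U i ω :=
    Finset.measurable_fun_sum _ fun i _ => C.measurable_U i
  have hEm : MeasurableSet E :=
    (measurableSet_eq_fun (C.poisson.measurable θ) measurable_const).inter
      (measurableSet_eq_fun hsum measurable_const)
  have hf1 : Measurable fun ω (t : ℝ≥0) => (C.N (θ + t) ω : ℝ) - C.N θ ω :=
    measurable_pi_lambda _ fun t => C.poisson.measurable_increment _ _
  have hf2 : Measurable fun ω i => C.U (k + i) ω := measurable_pi_lambda _ fun i => C.measurable_U _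
  have hfm : Measurable f := hf1.prodMk hf2
  have hi : IndepFun (fun ω => ((C.N θ ω : ℝ), fun t : ℝ≥0 => (C.N (θ + t) ω : ℝ) - C.N θ ω))
      (fun ω => (∑ i ∈ Finset.range k, C.U i ω, fun i => C.U (k + i) ω)) μ := by
    refine C.indepFun_number_claimSizes.comp
      (φ := fun n : ℝ≥0 → ℝ => (n θ, fun t : ℝ≥0 => n (θ + t) - n θ))
      (ψ := fun u : ℕ → ℝ => (∑ i ∈ Finset.range k, u i, fun i => u (k + i))) ?_ ?_ <;> fun_prop
  -- On rectangles four independent pieces factor: `N θ`, the increments after `θ`, the sum of the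
  -- first `k` sizes, and the later sizes. Rectangles determine the product measure.
  have hrect : ∀ (A : Set (ℝ≥0 → ℝ)) (B : Set (ℕ → ℝ)), MeasurableSet A → MeasurableSet B →
      (μ.restrict E).map f (A ×ˢ B)
        = (μ E • μ.map C.numberPath) A * (μ.map fun ω i => C.U i ω) B := by
    intro A B hA hB
    have e1 : f ⁻¹' (A ×ˢ B) ∩ E
        = (fun ω => ((C.N θ ω : ℝ), fun t : ℝ≥0 => (C.N (θ + t) ω : ℝ) - C.N θ ω)) ⁻¹' ({(k : ℝ)} ×ˢ A) ∩
          (fun ω => (∑ i ∈ Finset.range k, C.U i ω, fun i => C.U (k + i) ω)) ⁻¹' ({0} ×ˢ B) := by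
      ext ω
      simp only [hf, hE, mem_inter_iff, mem_preimage, mem_prod, mem_ofPred_eq, mem_singleton_iff,
        Nat.cast_inj]
      tauto
    have e2 : E = (fun ω => (C.N θ ω : ℝ)) ⁻¹' {(k : ℝ)} ∩
        (fun ω => ∑ i ∈ Finset.range k, C.U i ω) ⁻¹' {0} := by
      ext ω
      simp only [hE, mem_inter_iff, mem_preimage, mem_ofPred_eq, mem_singleton_iff, Nat.cast_inj]
    have hi0 : IndepFun (fun ω => (C.N θ ω : ℝ)) (fun ω => ∑ i ∈ Finset.range k, C.U i ω) μ :=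
      hi.comp measurable_fst measurable_fst
    have i1 := (C.poisson.indepFun_shift θ).measure_inter_preimage_eq_mul {(k : ℝ)} A
      (measurableSet_singleton _) hA
    have i2 := (C.indepFun_claimSizes k).measure_inter_preimage_eq_mul {0} B
      (measurableSet_singleton _) hB
    have i3 := hi0.measure_inter_preimage_eq_mul {(k : ℝ)} {0} (measurableSet_singleton _)
      (measurableSet_singleton _)
    rw [Measure.map_apply hfm (hA.prod hB), Measure.restrict_apply (hfm (hA.prod hB)), e1,
      hi.measure_inter_preimage_eq_mul _ _ ((measurableSet_singleton _).prod hA)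
        ((measurableSet_singleton _).prod hB)]
    simp only [mk_preimage_prod]
    rw [i1, i2, Measure.smul_apply, smul_eq_mul, e2, i3, ← C.map_shift_claimSizes k,
      Measure.map_apply hf2 hB, show μ.map C.numberPath = _ from (C.poisson.map_shift θ).symm,
      Measure.map_apply hf1 hA]
    ring
  have : IsFiniteMeasure (μ E • μ.map C.numberPath) := Measure.smul_finite _ (measure_ne_top μ E)
  have : IsProbabilityMeasure (μ.map fun ω i => C.U i ω) :=
    Measure.isProbabilityMeasure_map C.measurable_claimSizes.aemeasurable
  have h := (Measure.prod_eq hrect).symm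
  rw [inter_comm]
  change μ (f ⁻¹' D ∩ E) = _
  rw [← Measure.restrict_apply (hfm hD), ← Measure.map_apply hfm hD, h,
    Measure.prod_smul_left, Measure.smul_apply, smul_eq_mul]

/-- Given that no claim amount has accrued up to time `θ`, the later claims have their
unconditional law. -/
theorem map_shiftPath (θ : ℝ≥0) :
    (μ.restrict {ω | C.Y θ ω = 0}).map (C.shiftPath θ) = μ {ω | C.Y θ ω = 0} • μ.map C.path := by
  set E : ℕ → Set Ω := fun k => {ω | C.N θ ω = k ∧ ∑ i ∈ Finset.range k, C.U i ω = 0} with hE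
  have hEm : ∀ k, MeasurableSet (E k) := fun k =>
    (measurableSet_eq_fun (C.poisson.measurable θ) measurable_const).inter
      (measurableSet_eq_fun (Finset.measurable_fun_sum _ fun i _ => C.measurable_U i)
        measurable_const)
  have hdisj : Pairwise (Function.onFun Disjoint E) := fun j k hjk =>
    Set.disjoint_left.2 fun ω h1 h2 => hjk (h1.1.symm.trans h2.1)
  -- Fixing the number of claims up to `θ` fixes the index from which the later sizes are read.
  have hG : {ω | C.Y θ ω = 0} = ⋃ k, E k := by
    ext ω
    simp [hE, Y]
  ext B hB
  have hpre : MeasurableSet (C.shiftPath θ ⁻¹' B) := C.measurable_shiftPath θ hB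
  have hk : ∀ k, μ (C.shiftPath θ ⁻¹' B ∩ E k) = μ (E k) * μ.map C.path B := by
    intro k
    rw [C.map_path, Measure.map_apply measurable_compound hB,
      ← C.measure_inter_shift θ k (measurable_compound hB), inter_comm]
    refine measure_congr ?_
    filter_upwards [C.poisson.monotone] with ω hmono
    refine propext (and_congr_right fun hω => ?_)
    change C.shiftPath θ ω ∈ B ↔
      compound (fun t : ℝ≥0 => (C.N (θ + t) ω : ℝ) - C.N θ ω, fun i => C.U (k + i) ω) ∈ B
    suffices C.shiftPath θ ω =
      compound (fun t : ℝ≥0 => (C.N (θ + t) ω : ℝ) - C.N θ ω, fun i => C.U (k + i) ω) by rw [this]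
    ext t
    have hle : C.N θ ω ≤ C.N (θ + t) ω := hmono le_self_add
    simp only [shiftPath, compound, Y]
    rw [← Nat.cast_sub hle, Nat.floor_natCast, ← hω.1]
    obtain ⟨m, hm⟩ := exists_add_of_le hle
    rw [hm, Finset.sum_range_add, add_sub_cancel_left, Nat.add_sub_cancel_left]
  rw [Measure.map_apply (C.measurable_shiftPath θ) hB, Measure.restrict_apply hpre, hG,
    inter_iUnion, measure_iUnion (fun j k hjk => (hdisj hjk).mono inter_subset_right inter_subset_right)
      fun k => hpre.inter (hEm k), Measure.smul_apply, smul_eq_mul, measure_iUnion hdisj hEm,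
    ← ENNReal.tsum_mul_right]
  exact tsum_congr hk

omit [IsProbabilityMeasure μ] in
theorem ae_path : ∀ᵐ ω ∂μ, Monotone (C.path ω) ∧ C.path ω 0 = 0 ∧
    ∀ t, ContinuousWithinAt (C.path ω) (Ici t) t := by
  have hU : ∀ᵐ ω ∂μ, ∀ i, 0 ≤ C.U i ω := by
    refine ae_all_iff.2 fun i => ?_
    have h := C.nonneg_law
    rw [← C.law_U i, Measure.map_apply (C.measurable_U i) measurableSet_Iio] at h
    filter_upwards [measure_eq_zero_iff_ae_notMem.1 h] with ω hω
    exact not_lt.1 hω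
  filter_upwards [hU, C.poisson.zero, C.poisson.monotone, C.poisson.rightCont] with ω hU h0 hm hc
  refine ⟨fun s t hst => ?_, ?_, fun t => ?_⟩
  · exact Finset.sum_le_sum_of_subset_of_nonneg (Finset.range_subset_range.2 (hm hst))
      fun i _ _ => hU i
  · simp [path, Y, h0]
  · have hf : Continuous fun n : ℕ => ∑ i ∈ Finset.range n, C.U i ω := continuous_of_discreteTopology
    exact hf.continuousAt.comp_continuousWithinAt (hc t)

omit [IsProbabilityMeasure μ] in
-- Without claims no amount accrues; the inequality can be strict because claims of size zero are
-- allowed.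
theorem le_measure_Y_eq_zero (hlam : 0 < lam) (θ : ℝ≥0) :
    ENNReal.ofReal (Real.exp (-(lam * θ))) ≤ μ {ω | C.Y θ ω = 0} := by
  rw [← C.poisson.measure_eq_zero hlam θ]
  refine measure_mono fun ω (hω : C.N θ ω = 0) => ?_
  simp [Y, hω]

end Claims

/-! ### Strategies as non-anticipating functionals of the claim path -/

/-- The σ-algebra of paths generated by the values up to time `q`. -/
@[reducible] def pathsUpTo (q : ℝ≥0) : MeasurableSpace (ℝ≥0 → ℝ) :=
  ⨆ s ≤ q, MeasurableSpace.comap (fun w : ℝ≥0 → ℝ => w s) inferInstance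

theorem pathsUpTo_le (q : ℝ≥0) : pathsUpTo q ≤ MeasurableSpace.pi :=
  iSup₂_le fun s _ => (measurable_pi_apply s).comap_le

theorem measurable_toReal_iInf_ite {A : Type*} {mA : MeasurableSpace A} {T : ℚ → A → Prop}
    [∀ c, DecidablePred (T c)] (hT : ∀ c, MeasurableSet {w | T c w}) :
    Measurable fun w => (⨅ c : ℚ, if T c w then ENNReal.ofReal c else ⊤).toReal :=
  (Measurable.iInf fun c => Measurable.ite (hT c) measurable_const measurable_const).ennreal_toReal

theorem stronglyMeasurable_toReal_iSup {A : Type*} {mA : MeasurableSpace A} {f : ℕ → A → ℝ≥0∞}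
    (hf : ∀ n, Measurable (f n)) : StronglyMeasurable fun w => (⨆ n, f n w).toReal :=
  (Measurable.iSup hf).ennreal_toReal.stronglyMeasurable

theorem measurable_predictable_Ioi {Ω : Type*} {mΩ : MeasurableSpace Ω} {𝓕 : Filtration ℝ≥0 mΩ}
    {s : ℝ≥0} {Z : Ω → ℝ≥0∞} (hZ : Measurable[𝓕 s] Z) :
    Measurable[𝓕.predictable] fun q : ℝ≥0 × Ω => if s < q.1 then Z q.2 else 0 := by
  have hI : MeasurableSet[𝓕.predictable] {q : ℝ≥0 × Ω | s < q.1} := by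
    have := measurableSet_predictable_Ioi_prod (𝓕 := 𝓕) (i := s) (s := univ) MeasurableSet.univ
    convert this using 1
    ext; simp
  intro B hB
  have h1 : MeasurableSet[𝓕.predictable] (Ioi s ×ˢ (Z ⁻¹' B)) :=
    measurableSet_predictable_Ioi_prod (hZ hB)
  have : (fun q : ℝ≥0 × Ω => if s < q.1 then Z q.2 else 0) ⁻¹' B
      = (Ioi s ×ˢ (Z ⁻¹' B)) ∪ ({q : ℝ≥0 × Ω | s < q.1}ᶜ ∩ {_q | (0 : ℝ≥0∞) ∈ B}) := by
    ext ⟨t, ω⟩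
    by_cases h : s < t <;> simp [h]
  rw [this]
  exact h1.union (hI.compl.inter (MeasurableSet.const _))

variable {Ω : Type*} [mΩ : MeasurableSpace Ω] {μ : Measure Ω} {lam : ℝ} {F : Measure ℝ}

namespace Claims

variable (C : Claims μ lam F) [μ.IsComplete]

/-- Apart from predictability, admissibility is a condition on single paths, so the deterministic
results apply for almost every `ω`. -/
theorem isAdmissible_iff {p r α x : ℝ} {L R : ℝ≥0 → Ω → ℝ} : C.IsAdmissible p r α x L R ↔
    IsStronglyPredictable C.filtration L ∧
    ∀ᵐ ω ∂μ, AdmissiblePath p r α x (C.path ω) (fun t => L t ω) (fun t => R t ω) := by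
  constructor
  · intro h
    refine ⟨h.predictable, ?_⟩
    filter_upwards [C.ae_path, h.zero, h.monotone, h.leftCont, h.reserve, h.lump_le]
      with ω ⟨h1, h2, h3⟩ h4 h5 h6 h7 h8
    refine ⟨h1, h2, h3, h5, h4, h6, fun t => ⟨(h7 t).1, ?_⟩, h8⟩
    rw [(h7 t).2]; simp only [path]; ring
  · rintro ⟨hp, h⟩
    refine ⟨hp, h.mono fun ω h => h.zero, h.mono fun ω h => h.mono, h.mono fun ω h => h.leftCont,
      h.mono fun ω h t => ⟨(h.reserve t).1, ?_⟩, h.mono fun ω h => h.lump_le⟩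
    rw [(h.reserve t).2]; simp only [path]; ring

omit [μ.IsComplete] in
theorem returnValue_eq (p α δ : ℝ) (L R : ℝ≥0 → Ω → ℝ) :
    returnValue μ p α δ L R = ∫⁻ ω, pathReturn p α δ (fun t => L t ω) (fun t => R t ω) ∂μ := rfl

theorem measurable_Y_filtration {s t : ℝ≥0} (hst : s ≤ t) : Measurable[C.filtration t] (C.Y s) := by
  refine (comap_measurable (C.Y s)).mono ?_ le_rfl
  exact (le_iSup₂ (f := fun s (_ : s ≤ t) => MeasurableSpace.comap (C.Y s) inferInstance)
    s hst).trans le_sup_left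

theorem measurable_shiftPath_filtration (θ q : ℝ≥0) :
    Measurable[C.filtration (θ + q), pathsUpTo q] (C.shiftPath θ) := by
  rw [measurable_iff_comap_le, MeasurableSpace.comap_iSup]
  refine iSup_le fun s => ?_
  rw [MeasurableSpace.comap_iSup]
  refine iSup_le fun hs => ?_
  rw [MeasurableSpace.comap_comp, ← measurable_iff_comap_le]
  exact (C.measurable_Y_filtration (add_le_add_right hs θ)).sub
    (C.measurable_Y_filtration le_self_add)

/-- The sets almost surely equal to a path event up to time `q` form a σ-algebra, and it contains
both the generators from `Y` and the null sets. -/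
theorem exists_preimage_ae_eq {q : ℝ≥0} {S : Set Ω} (hS : MeasurableSet[C.filtration q] S) :
    ∃ T, MeasurableSet[pathsUpTo q] T ∧ S =ᵐ[μ] C.path ⁻¹' T := by
  have hle : C.filtration q ≤
      eventuallyMeasurableSpace (MeasurableSpace.comap C.path (pathsUpTo q)) (ae μ) := by
    refine sup_le (iSup₂_le fun s hs => ?_) (MeasurableSpace.generateFrom_le fun A hA => ?_)
    · refine le_trans ?_ le_eventuallyMeasurableSpace
      rintro _ ⟨B, hB, rfl⟩
      refine ⟨(fun w => w s) ⁻¹' B, ?_, rfl⟩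
      exact le_iSup₂ (f := fun s (_ : s ≤ q) =>
        MeasurableSpace.comap (fun w : ℝ≥0 → ℝ => w s) inferInstance) s hs _ ⟨B, hB, rfl⟩
    · exact ⟨∅, @MeasurableSet.empty _ (_), ae_eq_empty.2 hA⟩
  obtain ⟨_, ⟨T, hT, rfl⟩, h⟩ := hle S hS
  exact ⟨T, hT, h⟩

/-- A nonnegative random variable known at time `q` is a function of the claim path up to `q`. -/
theorem exists_factor {q : ℝ≥0} {f : Ω → ℝ} (hf : Measurable[C.filtration q] f)
    (hf0 : ∀ᵐ ω ∂μ, 0 ≤ f ω) :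
    ∃ g : (ℝ≥0 → ℝ) → ℝ, Measurable[pathsUpTo q] g ∧ ∀ᵐ ω ∂μ, f ω = g (C.path ω) := by
  classical
  have h : ∀ c : ℚ, ∃ T, MeasurableSet[pathsUpTo q] T ∧ {ω | f ω < c} =ᵐ[μ] C.path ⁻¹' T :=
    fun c => C.exists_preimage_ae_eq (hf measurableSet_Iio)
  choose T hT hTf using h
  -- `f` is recovered from its rational sublevel sets, as the infimum of the `c` with `f < c`; since
  -- `f ≥ 0` almost surely, such `c` are positive there.
  refine ⟨fun w => (⨅ c : ℚ, if w ∈ T c then ENNReal.ofReal c else ⊤).toReal, ?_, ?_⟩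
  · exact measurable_toReal_iInf_ite (T := fun c w => w ∈ T c) hT
  · filter_upwards [hf0, ae_all_iff.2 hTf] with ω h0 hω
    have hmem : ∀ c, C.path ω ∈ T c ↔ f ω < c := fun c => (iff_of_eq (hω c)).symm
    simp only [hmem]
    suffices (⨅ c : ℚ, if f ω < c then ENNReal.ofReal c else ⊤) = ENNReal.ofReal (f ω) by
      rw [this, ENNReal.toReal_ofReal h0]
    refine le_antisymm ?_ (le_iInf fun c => ?_)
    · refine le_of_forall_gt_imp_ge_of_dense fun b hb => ?_
      by_cases hbt : b = ⊤
      · rw [hbt]; exact le_top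
      · obtain ⟨c, hc1, hc2⟩ := exists_rat_btwn ((ENNReal.ofReal_lt_iff_lt_toReal h0 hbt).1 hb)
        refine iInf_le_of_le c ?_
        rw [if_pos hc1]
        exact ENNReal.ofReal_le_of_le_toReal hc2.le
    · split_ifs with hc
      · exact ENNReal.ofReal_le_ofReal hc.le
      · exact le_top

/-- After time `θ`, and only if no claim amount has accrued by then, pay the dividends with
samples `g n`, evaluated at the claims after time `θ`. -/
noncomputable def delayed (θ : ℝ≥0) (g : ℕ → (ℝ≥0 → ℝ) → ℝ) (t : ℝ≥0) (ω : Ω) : ℝ :=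
  if C.Y θ ω = 0 then lower (fun n => g n (C.shiftPath θ ω)) (t - θ) else 0

/-- Each term of the supremum in `lower` is known at time `θ + denseTime n` and is switched on
strictly later, hence is predictable. This uses that `Y θ = 0` is decided at time `θ`. -/
theorem isStronglyPredictable_delayed (θ : ℝ≥0) {g : ℕ → (ℝ≥0 → ℝ) → ℝ}
    (hg : ∀ n, Measurable[pathsUpTo (denseTime n)] (g n)) :
    IsStronglyPredictable C.filtration (C.delayed θ g) := by
  have hZ : ∀ n, Measurable[C.filtration (θ + denseTime n)]
      fun ω => if C.Y θ ω = 0 then ENNReal.ofReal (g n (C.shiftPath θ ω)) else 0 := by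
    intro n
    refine Measurable.ite ?_ (Measurable.ennreal_ofReal ?_) measurable_const
    · exact C.measurable_Y_filtration le_self_add (measurableSet_singleton 0)
    · exact (hg n).comp (C.measurable_shiftPath_filtration θ (denseTime n))
  have h : Function.uncurry (C.delayed θ g) = fun q : ℝ≥0 × Ω =>
      (⨆ n, if θ + denseTime n < q.1 then
        (if C.Y θ q.2 = 0 then ENNReal.ofReal (g n (C.shiftPath θ q.2)) else 0) else 0).toReal := by
    ext ⟨t, ω⟩
    simp only [Function.uncurry, delayed, lower, lt_tsub_iff_left]
    by_cases hω : C.Y θ ω = 0 <;> simp [hω]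
  rw [IsStronglyPredictable, h]
  exact stronglyMeasurable_toReal_iSup fun n => measurable_predictable_Ioi (hZ n)

end Claims

theorem measurable_predictable_zero {Ω : Type*} {mΩ : MeasurableSpace Ω} (𝓕 : Filtration ℝ≥0 mΩ) :
    MeasurableSet[𝓕.predictable] {q : ℝ≥0 × Ω | q.1 = 0} := by
  have := measurableSet_predictable_singleton_bot_prod (𝓕 := 𝓕) (s := univ) MeasurableSet.univ
  convert this using 1
  ext; simp

theorem isStronglyPredictable_withLump {Ω : Type*} {mΩ : MeasurableSpace Ω}
    {𝓕 : Filtration ℝ≥0 mΩ} {L : ℝ≥0 → Ω → ℝ} (hL : IsStronglyPredictable 𝓕 L) (c : ℝ) :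
    IsStronglyPredictable 𝓕 fun t ω => withLump c (fun s => L s ω) t :=
  StronglyMeasurable.ite (measurable_predictable_zero 𝓕) stronglyMeasurable_const
    (hL.add stronglyMeasurable_const)

/-! ### Estimates for the value function -/

namespace Claims

variable {Ω : Type*} [mΩ : MeasurableSpace Ω] {μ : Measure Ω} {lam : ℝ} {F : Measure ℝ}
  (C : Claims μ lam F) [μ.IsComplete] [IsProbabilityMeasure μ] {p r α δ : ℝ}

theorem optimalReturn_ne_top (hp : 0 < p) (hr : 0 < r) (hα : r < α) (hδ : r < δ) (x : ℝ) :
    C.optimalReturn p r α δ x ≠ ⊤ := by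
  have hA : 0 ≤ max x 0 + p / r := by have := le_max_right x 0; positivity
  have hB : 0 ≤ p / α := div_nonneg hp.le (hr.trans hα).le
  refine ne_top_of_le_ne_top (discounted_exp_ne_top hr hδ hA hB) ?_
  refine iSup_le fun L => iSup_le fun R => iSup_le fun h => ?_
  calc returnValue μ p α δ L R ≤ ∫⁻ _, _ ∂μ :=
        lintegral_mono_ae ((C.isAdmissible_iff.1 h).2.mono fun ω hω =>
          hω.pathReturn_le hp hr hα hδ)
    _ = _ := by simp

omit [IsProbabilityMeasure μ] in
theorem le_optimalReturn {x : ℝ} {L R : ℝ≥0 → Ω → ℝ} (h : C.IsAdmissible p r α x L R) :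
    returnValue μ p α δ L R ≤ C.optimalReturn p r α δ x :=
  le_iSup_of_le L (le_iSup_of_le R (le_iSup_of_le h le_rfl))

theorem admissiblePath_zero (hr : 0 < r) (hα : r < α) (x : ℝ) {y : ℝ≥0 → ℝ} (hy : Monotone y)
    (hy0 : y 0 = 0) (hyc : ∀ t, ContinuousWithinAt y (Ici t) t) :
    AdmissiblePath p r α x y (fun _ => 0) (reserveOf p r α x fun t => y t + 0) := by
  refine ⟨hy, hy0, hyc, monotone_const, rfl, fun _ => continuousWithinAt_const,
    isReservePath_reserveOf hr hα x (hy.add_const 0), fun t _ => ?_⟩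
  rw [rightLim_eq_of_tendsto (f := fun _ : ℝ≥0 => (0 : ℝ)) tendsto_const_nhds]
  simp

omit [IsProbabilityMeasure μ] in
theorem exists_isAdmissible (hr : 0 < r) (hα : r < α) (x : ℝ) :
    ∃ L R, C.IsAdmissible p r α x L R := by
  refine ⟨fun _ _ => 0, fun t ω => reserveOf p r α x (fun t => C.path ω t + 0) t,
    C.isAdmissible_iff.2 ⟨stronglyMeasurable_const, ?_⟩⟩
  filter_upwards [C.ae_path] with ω ⟨h1, h2, h3⟩
  exact admissiblePath_zero hr hα x h1 h2 h3

theorem returnValue_add_le (hδ : 0 < δ) {x c : ℝ} (hx : -(p / α) < x) (hc : 0 ≤ c)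
    {L R : ℝ≥0 → Ω → ℝ} (h : C.IsAdmissible p r α x L R) :
    returnValue μ p α δ L R + ENNReal.ofReal c ≤ C.optimalReturn p r α δ (x + c) := by
  obtain ⟨hL, hpath⟩ := C.isAdmissible_iff.1 h
  have hadm : C.IsAdmissible p r α (x + c) (fun t ω => withLump c (fun s => L s ω) t)
      (fun t ω => Function.update (fun s => R s ω) 0 (x + c) t) :=
    C.isAdmissible_iff.2 ⟨isStronglyPredictable_withLump hL c,
      hpath.mono fun ω hω => (hω.addLump hx hc).1⟩
  refine le_trans (le_of_eq ?_) (C.le_optimalReturn hadm)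
  rw [returnValue_eq, returnValue_eq]
  have : ∫⁻ _, ENNReal.ofReal c ∂μ = ENNReal.ofReal c := by simp
  nth_rw 1 [← this]
  rw [← lintegral_add_right _ measurable_const]
  exact lintegral_congr_ae (hpath.mono fun ω hω => (hω.pathReturn_withLump hδ hx hc).symm)

theorem optimalReturn_add_le (hr : 0 < r) (hα : r < α) (hδ : 0 < δ) {x c : ℝ}
    (hx : -(p / α) < x) (hc : 0 ≤ c) :
    C.optimalReturn p r α δ x + ENNReal.ofReal c ≤ C.optimalReturn p r α δ (x + c) := by
  -- Moving `c` across by truncated subtraction requires `c` to be at most the right-hand side; any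
  -- one admissible strategy shows this.
  obtain ⟨L₀, R₀, h₀⟩ := C.exists_isAdmissible (p := p) hr hα x
  have hle : ENNReal.ofReal c ≤ C.optimalReturn p r α δ (x + c) :=
    le_add_self.trans (C.returnValue_add_le hδ hx hc h₀)
  rw [← tsub_add_cancel_of_le hle]
  gcongr
  refine iSup_le fun L => iSup_le fun R => iSup_le fun h => ?_
  exact ENNReal.le_sub_of_add_le_right ENNReal.ofReal_ne_top (C.returnValue_add_le hδ hx hc h)

/-- Waiting until the reserve has climbed from `x` to `z` costs at most the discounting and the
probability of a claim. -/
theorem mul_optimalReturn_le (hr : 0 < r) (hα : r < α) (hδ : 0 < δ) (hlam : 0 < lam) {x z : ℝ}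
    {θ : ℝ≥0} {ψ : ℝ → ℝ} (hψ : IsClimb p r α x z θ ψ) :
    ENNReal.ofReal (Real.exp (-((lam + δ) * θ))) * C.optimalReturn p r α δ z
      ≤ C.optimalReturn p r α δ x := by
  classical
  simp only [optimalReturn, ENNReal.mul_iSup]
  refine iSup_le fun L => iSup_le fun R => iSup_le fun h => ?_
  obtain ⟨hL, hpath⟩ := C.isAdmissible_iff.1 h
  -- Only countably many times are used, so the exceptional null sets can be discarded together.
  have hfactor : ∀ n, ∃ g : (ℝ≥0 → ℝ) → ℝ, Measurable[pathsUpTo (denseTime n)] g ∧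
      ∀ᵐ ω ∂μ, L (denseTime n) ω = g (C.path ω) := fun n =>
    C.exists_factor (hL.stronglyAdapted (denseTime n)).measurable
      (hpath.mono fun ω hω => hω.zero.ge.trans (hω.mono zero_le))
  choose g hg hgL using hfactor
  set J : (ℝ≥0 → ℝ) → (ℕ → ℝ) × (ℕ → ℝ) :=
    fun w => (fun n => w (denseTime n), fun n => g n w) with hJ
  have hJm : Measurable J :=
    (measurable_pi_lambda _ fun n => measurable_pi_apply _).prodMk
      (measurable_pi_lambda _ fun n => (hg n).mono (pathsUpTo_le _) le_rfl)
  have hsample : ∀ᵐ ω ∂μ, IsAdmissibleSample p r α z (J (C.path ω)) ∧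
      sampleReturn p r α δ z (J (C.path ω))
        = pathReturn p α δ (fun t => L t ω) (fun t => R t ω) := by
    filter_upwards [hpath, ae_all_iff.2 hgL] with ω hω hgω
    have : J (C.path ω) = (fun n => C.path ω (denseTime n), fun n => L (denseTime n) ω) := by
      simp only [hJ, hgω]
    rw [this]
    exact hω.sample hr hα hδ
  set G : Set Ω := {ω | C.Y θ ω = 0} with hG
  have hGm : MeasurableSet G := measurableSet_eq_fun (C.measurable_Y θ) measurable_const
  -- Admissibility is a measurable condition on the claim path that holds almost surely, and on `G`
  -- the law of the shifted claims is a multiple of the law of the claims.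
  have hgood : ∀ᵐ ω ∂μ, ω ∈ G → IsAdmissibleSample p r α z (J (C.shiftPath θ ω)) := by
    rw [← ae_restrict_iff' hGm]
    have hms : MeasurableSet {w | IsAdmissibleSample p r α z (J w)} :=
      (measurableSet_isAdmissibleSample hr hα z).preimage hJm
    refine ae_of_ae_map (C.measurable_shiftPath θ).aemeasurable
      (p := fun w => IsAdmissibleSample p r α z (J w)) ?_
    rw [C.map_shiftPath θ]
    refine Measure.ae_smul_measure ?_ _
    exact (ae_map_iff C.measurable_path.aemeasurable hms).2 (hsample.mono fun ω hω => hω.1)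
  -- Off `G` nothing is ever paid, and the reserve is the dividend-free one.
  set R' : ℝ≥0 → Ω → ℝ := fun t ω =>
    if C.Y θ ω = 0 then climbThen θ ψ (sampleReserve p r α z (J (C.shiftPath θ ω))) t
    else reserveOf p r α x (fun t => C.path ω t + 0) t with hR'
  have hshift : ∀ᵐ ω ∂μ, ω ∈ G →
      AdmissiblePath p r α z (C.shiftPath θ ω) (lower fun n => g n (C.shiftPath θ ω))
        (sampleReserve p r α z (J (C.shiftPath θ ω))) ∧
      ∀ t, C.path ω t = C.shiftPath θ ω (t - θ) := by
    filter_upwards [hgood, C.ae_path] with ω hω ⟨h1, h2, h3⟩ hωG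
    have hY0 : C.path ω θ = 0 := hωG
    have hsh : ∀ t, C.shiftPath θ ω t = C.path ω (θ + t) := fun t => by
      change C.path ω (θ + t) - C.path ω θ = _
      rw [hY0, sub_zero]
    refine ⟨IsAdmissibleSample.admissiblePath hr hα (hω hωG) ?_ ?_ ?_, fun t => ?_⟩
    · intro s t hst
      rw [hsh, hsh]
      exact h1 (add_le_add_right hst θ)
    · rw [hsh, add_zero, hY0]
    · intro t
      rw [funext hsh]
      refine (h3 (θ + t)).comp (f := fun t => θ + t)
        (by fun_prop : Continuous fun t : ℝ≥0 => θ + t).continuousWithinAt fun s hs => ?_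
      exact add_le_add_right (show t ≤ s from hs) θ
    · rw [hsh]
      -- Before `θ` the nondecreasing claim path lies between its values at `0` and `θ`, which are
      -- both zero.
      rcases le_total θ t with ht | ht
      · rw [add_tsub_cancel_of_le ht]
      · rw [tsub_eq_zero_of_le ht, add_zero, hY0]
        exact le_antisymm (hY0 ▸ h1 ht) (h2 ▸ h1 zero_le)
  have hadm : C.IsAdmissible p r α x (C.delayed θ g) R' := by
    refine C.isAdmissible_iff.2 ⟨C.isStronglyPredictable_delayed θ hg, ?_⟩
    filter_upwards [hshift, C.ae_path] with ω hω ⟨h1, h2, h3⟩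
    by_cases hωG : C.Y θ ω = 0
    · simp only [delayed, hR', if_pos hωG]
      exact (hω hωG).1.afterClimb hψ hr hα (hω hωG).2
    · simp only [delayed, hR', if_neg hωG]
      exact admissiblePath_zero hr hα x h1 h2 h3
  refine le_trans ?_ (C.le_optimalReturn hadm)
  have hSm : Measurable fun w => sampleReturn p r α δ z (J w) :=
    (measurable_sampleReturn hr hα δ z).comp hJm
  have hexp : ENNReal.ofReal (Real.exp (-((lam + δ) * θ)))
      = ENNReal.ofReal (Real.exp (-(δ * θ))) * ENNReal.ofReal (Real.exp (-(lam * θ))) := by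
    rw [← ENNReal.ofReal_mul (Real.exp_pos _).le, ← Real.exp_add]
    congr 2
    ring
  calc ENNReal.ofReal (Real.exp (-((lam + δ) * θ))) * returnValue μ p α δ L R
      ≤ ENNReal.ofReal (Real.exp (-(δ * θ))) * (μ G * returnValue μ p α δ L R) := by
        rw [hexp, mul_assoc]
        gcongr
        exact C.le_measure_Y_eq_zero hlam θ
    _ = ENNReal.ofReal (Real.exp (-(δ * θ))) *
          ∫⁻ ω in G, sampleReturn p r α δ z (J (C.shiftPath θ ω)) ∂μ := by
        -- The return is a functional of the claim path, so the law of the shifted claims on `G`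
        -- turns its integral over `G` into `μ G` times the full expectation.
        rw [← lintegral_map hSm (C.measurable_shiftPath θ), C.map_shiftPath θ, lintegral_smul_measure,
          lintegral_map hSm C.measurable_path, returnValue_eq,
          lintegral_congr_ae (hsample.mono fun ω hω => hω.2), smul_eq_mul]
    _ = ∫⁻ ω in G, ENNReal.ofReal (Real.exp (-(δ * θ))) *
          sampleReturn p r α δ z (J (C.shiftPath θ ω)) ∂μ :=
        (lintegral_const_mul' _ _ ENNReal.ofReal_ne_top).symm
    _ ≤ ∫⁻ ω in G, pathReturn p α δ (fun t => C.delayed θ g t ω) (fun t => R' t ω) ∂μ := by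
        refine lintegral_mono_ae ((ae_restrict_iff' hGm).2 ?_)
        filter_upwards [hshift, hgood] with ω hω hω' hωG
        have hωY : C.Y θ ω = 0 := hωG
        obtain ⟨hp1, -⟩ := hω hωG
        have hret : sampleReturn p r α δ z (J (C.shiftPath θ ω))
            = pathReturn p α δ (lower fun n => g n (C.shiftPath θ ω))
              (sampleReserve p r α z (J (C.shiftPath θ ω))) := by
          rw [hp1.pathReturn_eq hδ, sampleReturn,
            hp1.reserve.ruinTime_eq hr hα (hp1.claims_mono.add hp1.mono)]
          congr 1
          ext t
          exact ((hω' hωG).1.rightLim_lower t).symm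
        rw [hret]
        simp only [delayed, hR', if_pos hωY]
        exact hp1.le_pathReturn_climbThen hψ hr hα hδ
    _ ≤ returnValue μ p α δ (C.delayed θ g) R' := by
        rw [returnValue_eq]
        exact setLIntegral_le_lintegral _ _

theorem V_le_of_isClimb (hp : 0 < p) (hr : 0 < r) (hα : r < α) (hδ : r < δ) (hlam : 0 < lam) {x z : ℝ}
    {θ : ℝ≥0} {ψ : ℝ → ℝ} (hψ : IsClimb p r α x z θ ψ) :
    C.V p r α δ z ≤ C.V p r α δ x * Real.exp ((lam + δ) * θ) := by
  have h := C.mul_optimalReturn_le hr hα (hr.trans hδ) hlam hψ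
  have h2 := ENNReal.toReal_mono (C.optimalReturn_ne_top hp hr hα hδ x) h
  rw [ENNReal.toReal_mul, ENNReal.toReal_ofReal (Real.exp_pos _).le] at h2
  change Real.exp (-((lam + δ) * θ)) * C.V p r α δ z ≤ C.V p r α δ x at h2
  calc C.V p r α δ z
      = Real.exp (-((lam + δ) * θ)) * C.V p r α δ z * Real.exp ((lam + δ) * θ) := by
        rw [mul_right_comm, ← Real.exp_add]; simp
    _ ≤ _ := by gcongr

theorem V_le (hp : 0 < p) (hr : 0 < r) (hα : r < α) (hδ : r < δ) (hlam : 0 < lam) {x y : ℝ}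
    (hx : -(p / α) < x) (hxy : x < y) :
    C.V p r α δ y ≤ C.V p r α δ x * Real.exp ((lam + δ) * t₀ p r α x y) := by
  have hα0 : 0 < α := hr.trans hα
  have hc : ∀ {x y θ : ℝ} {ψ : ℝ → ℝ}, IsClimb p r α x y θ.toNNReal ψ → 0 ≤ θ →
      C.V p r α δ y ≤ C.V p r α δ x * Real.exp ((lam + δ) * θ) := fun hψ hθ => by
    simpa [Real.coe_toNNReal _ hθ] using C.V_le_of_isClimb hp hr hα hδ hlam hψ
  have hcredit : ∀ {x y : ℝ}, 0 ≤ x → x < y → 0 ≤ t₀ p r α x y := fun {x y} h0 h => by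
    rw [t₀, if_pos h0]
    exact mul_nonneg (by positivity) (Real.log_nonneg (by
      rw [le_div_iff₀ (by positivity)]; nlinarith))
  have hdebit : ∀ {x y : ℝ}, -(p / α) < x → x < y → y ≤ 0 → 0 ≤ t₀ p r α x y :=
    fun {x y} h0 h h1 => by
      have : α * (x + p / α) = α * x + p := by field_simp
      have hpos : 0 < α * x + p := this ▸ mul_pos hα0 (by linarith)
      rw [t₀, if_neg (by linarith), if_neg (by linarith)]
      exact mul_nonneg (by positivity) (Real.log_nonneg (by
        rw [le_div_iff₀ hpos]; nlinarith))
  rcases le_or_gt 0 x with h0 | h0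
  · exact hc (isClimb_credit hp hr hα h0 hxy) (hcredit h0 hxy)
  rcases le_or_gt y 0 with h1 | h1
  · exact hc (isClimb_debit hr hα hx hxy h1) (hdebit hx hxy h1)
  -- The climb passes through `0`, where the interest rate changes: the two times add and the
  -- exponential factors multiply.
  · have e : t₀ p r α x y = t₀ p r α x 0 + t₀ p r α 0 y := by
      rw [t₀, t₀, t₀, if_neg (by linarith), if_pos h1, if_neg (by linarith), if_neg (lt_irrefl 0),
        if_pos le_rfl]
      simp only [mul_zero, zero_add]
      ring
    have a1 := hc (isClimb_debit hr hα hx h0 le_rfl) (hdebit hx h0 le_rfl)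
    have a2 := hc (isClimb_credit hp hr hα le_rfl h1) (hcredit le_rfl h1)
    calc _ ≤ C.V p r α δ 0 * Real.exp ((lam + δ) * t₀ p r α 0 y) := a2
      _ ≤ (C.V p r α δ x * Real.exp ((lam + δ) * t₀ p r α x 0)) *
            Real.exp ((lam + δ) * t₀ p r α 0 y) := by gcongr
      _ = _ := by rw [mul_assoc, ← Real.exp_add, e, mul_add]

end Claims

end DividendControl

theorem theorem3p2 {Ω : Type*} [MeasurableSpace Ω] (μ : Measure Ω) [IsProbabilityMeasure μ]
    [μ.IsComplete] (p r α δ lam : ℝ) (hp : 0 < p) (hr : 0 < r) (hα : r < α) (hδ : r < δ)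
    (hlam : 0 < lam) (F : Measure ℝ) (C : DividendControl.Claims μ lam F)
    (x y : ℝ) (hx : -(p / α) < x) (hxy : x < y) :
    C.optimalReturn p r α δ x ≠ ∞ ∧ C.optimalReturn p r α δ y ≠ ∞ ∧
    y - x ≤ C.V p r α δ y - C.V p r α δ x ∧
    C.V p r α δ y - C.V p r α δ x
      ≤ C.V p r α δ x * (Real.exp ((lam + δ) * DividendControl.t₀ p r α x y) - 1) ∧
    (0 ≤ x → C.V p r α δ y - C.V p r α δ x
      ≤ C.V p r α δ x * (((r * y + p) / (r * x + p)) ^ ((lam + δ) / r) - 1)) ∧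
    (x < 0 → 0 ≤ y → C.V p r α δ y - C.V p r α δ x
      ≤ C.V p r α δ x * (((r * y + p) / p) ^ ((lam + δ) / r)
          * (p / (α * x + p)) ^ ((lam + δ) / α) - 1)) ∧
    (y < 0 → C.V p r α δ y - C.V p r α δ x
      ≤ C.V p r α δ x * (((α * y + p) / (α * x + p)) ^ ((lam + δ) / α) - 1)) := by
  have hα0 : 0 < α := hr.trans hα
  have hfx := C.optimalReturn_ne_top hp hr hα hδ x
  have hfy := C.optimalReturn_ne_top hp hr hα hδ y
  have hmain : C.V p r α δ y - C.V p r α δ x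
      ≤ C.V p r α δ x * (Real.exp ((lam + δ) * DividendControl.t₀ p r α x y) - 1) := by
    have := C.V_le hp hr hα hδ hlam hx hxy
    linarith
  have hax : 0 < α * x + p := by
    have : α * (x + p / α) = α * x + p := by field_simp
    exact this ▸ mul_pos hα0 (by linarith)
  refine ⟨hfx, hfy, ?_, hmain, fun h0 => ?_, fun h0 h1 => ?_, fun h1 => ?_⟩
  · have h := C.optimalReturn_add_le (δ := δ) hr hα (hr.trans hδ) hx (sub_nonneg.2 hxy.le)
    rw [add_sub_cancel] at h
    have h2 := ENNReal.toReal_mono hfy h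
    rw [ENNReal.toReal_add hfx ENNReal.ofReal_ne_top,
      ENNReal.toReal_ofReal (sub_nonneg.2 hxy.le)] at h2
    change C.V p r α δ x + (y - x) ≤ C.V p r α δ y at h2
    linarith
  · convert hmain using 3
    have : 0 < r * y + p := by nlinarith
    rw [DividendControl.t₀, if_pos h0, Real.rpow_def_of_pos (by positivity)]
    congr 1
    ring
  · convert hmain using 3
    rw [Real.rpow_def_of_pos (by positivity), Real.rpow_def_of_pos (by positivity), ← Real.exp_add]
    congr 1
    rw [DividendControl.t₀, if_neg (by linarith)]
    -- At `y = 0` the time `t₀` is given by its third branch; the formulas agree because the credit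
    -- factor has base `p / p = 1`.
    rcases h1.lt_or_eq with h1 | rfl
    · rw [if_pos h1]; ring
    · rw [if_neg (lt_irrefl 0)]
      simp only [mul_zero, zero_add, div_self hp.ne', Real.log_one, zero_mul]
      ring
  · convert hmain using 3
    have : 0 < α * y + p := by nlinarith
    rw [DividendControl.t₀, if_neg (by linarith), if_neg (by linarith),
      Real.rpow_def_of_pos (by positivity)]
    congr 1
    ring
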